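/- Let $N\in\mathbb{N}$, let $\mathcal{K}=\ell^2(\mathbb{Z},\mathbb{C}^N)$, and let $S:\mathcal{K}\to\mathcal{K}$ be a bounded operator that commutes with the shift $(T\psi)_n=\psi_{n-1}$. Hence $\langle\delta_n,S\delta_{n'}\rangle=S_{n-n'}$ with matrices $S_m:\mathbb{C}^N\to\mathbb{C}^N$ $(m\in\mathbb{Z})$. Assume that they decay rapidly: $\sup_m(1+|m|)^k\|S_m\|<\infty$ for all $k\in\mathbb{N}$. On $\mathcal{K}\oplus\mathcal{K}$ let $$H=\begin{pmatrix}0&S^*\\S&0\end{pmatrix},\qquad \Pi=\begin{pmatrix}1&0\\0&-1\end{pmatrix}.$$ (i) The sum $S(z):=\sum_{m\in\mathbb{Z}}S_mz^{-m}$ converges absolutely for $|z|=1$. (ii) The spectral gap condition $0\notin\sigma(H)$ holds if and only if $\det S(z)\neq0$ for all $z$ on the unit circle $\mathcal{C}$. (iii) Suppose $0\notin\sigma(H)$. Then there is a unique unitary $U$ with $S=U|S|$, $|S|=(S^*S)^{1/2}$. Let $w\in\mathbb{Z}$ be the winding number around $0$ of $\mathcal{C}\ni z\mapsto\det S(z)$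 ($\mathcal{C}$ positively oriented), and let $\Sigma=\operatorname{sgn}H$. For every switch function $\Lambda:\mathbb{Z}\to\mathbb{R}$ (that is, $\Lambda(n)=1$ and $\Lambda(-n)=0$ for all sufficiently large $n$), acting as a multiplication operator on $\mathcal{K}$ and on $\mathcal{K}\oplus\mathcal{K}$, the operators $U^*[\Lambda,U]$ and $\Pi\Sigma[\Lambda,\Sigma]$ are trace class, and the bulk index $\mathcal{N}=\tfrac12\operatorname{tr}(\Pi\Sigma[\Lambda,\Sigma])$ satisfies $$\mathcal{N}=\operatorname{tr}U^*[\Lambda,U]=-w .$$ -/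

import Mathlib

noncomputable section

namespace ChiralChain

/-! ### Trace class operators and the trace on a complex Hilbert space -/

section TraceClass

universe u

variable {E : Type u} [NormedAddCommGroup E] [InnerProductSpace ℂ E] [CompleteSpace E]

/-- A bounded operator `T` is trace class if `∑ i, ⟪b i, |T| (b i)⟫ < ∞`, `|T| = (T† T) ^ (1/2)`,
for every Hilbert basis `b` (equivalently for one; the sum is the trace norm of `T`). -/
def IsTraceClass (T : E →L[ℂ] E) : Prop :=
  ∀ (ι : Type u) (b : HilbertBasis ι ℂ E),
    Summable fun i => (inner ℂ (b i) (CFC.abs T (b i))).re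

/-- The trace `tr T = ∑ i, ⟪b i, T (b i)⟫`, computed in some Hilbert basis `b`. It is meaningful
for trace class `T`, where the sum converges absolutely and does not depend on `b`. -/
def opTrace (T : E →L[ℂ] E) : ℂ :=
  ∑' i, inner ℂ ((exists_hilbertBasis ℂ E).choose_spec.choose i)
    (T ((exists_hilbertBasis ℂ E).choose_spec.choose i))

/-- `U` is a unitary factor in a polar decomposition of `S`: `S = U |S|`, `|S| = (S† S) ^ (1/2)`. -/
def IsPolarUnitary (S U : E →L[ℂ] E) : Prop :=
  U ∈ unitary (E →L[ℂ] E) ∧ S = U * CFC.abs S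

/-- The bounded operator on `E ⊕ E` (with the Hilbert space norm) given by the block matrix
`!![A, B; C, D]`. -/
def blockOp (A B C D : E →L[ℂ] E) : WithLp 2 (E × E) →L[ℂ] WithLp 2 (E × E) :=
  (WithLp.prodContinuousLinearEquiv 2 ℂ E E).symm.toContinuousLinearMap ∘L
    (A ∘L WithLp.fstL 2 ℂ E E + B ∘L WithLp.sndL 2 ℂ E E).prod
      (C ∘L WithLp.fstL 2 ℂ E E + D ∘L WithLp.sndL 2 ℂ E E)

/-- The chiral Hamiltonian `H = !![0, S†; S, 0]`. -/
def hamiltonian (S : E →L[ℂ] E) : WithLp 2 (E × E) →L[ℂ] WithLp 2 (E × E) :=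
  blockOp 0 (ContinuousLinearMap.adjoint S) S 0

/-- The chirality operator `Π = !![1, 0; 0, -1]`. -/
def chirality : WithLp 2 (E × E) →L[ℂ] WithLp 2 (E × E) :=
  blockOp 1 0 0 (-1)

/-- `Σ = sgn H`, by the continuous functional calculus. The function `sgn` is continuous on the
spectrum of the self-adjoint operator `H` as soon as `0` does not belong to the spectrum. -/
def signHamiltonian (S : E →L[ℂ] E) : WithLp 2 (E × E) →L[ℂ] WithLp 2 (E × E) :=
  cfc Real.sign (hamiltonian S)

end TraceClass

/-! ### The chain -/

/-- `𝒦 = ℓ²(ℤ, ℂ^N)`. -/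
abbrev Chain (N : ℕ) : Type :=
  lp (fun _ : ℤ => EuclideanSpace ℂ (Fin N)) 2

/-- Reindexing by the translation `n ↦ n - 1` keeps sequences in `ℓ²`. -/
theorem shift_memℓp {N : ℕ} (ψ : Chain N) :
    Memℓp (fun n : ℤ => ψ (n - 1)) 2 := by
  have h := (lp.memℓp ψ).summable (by norm_num)
  refine memℓp_gen ?_
  exact (Equiv.subRight (1 : ℤ)).summable_iff.mpr h

/-- The shift operator `(T ψ) n = ψ (n - 1)` on `𝒦`. -/
def shift (N : ℕ) : Chain N →L[ℂ] Chain N :=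
  LinearMap.mkContinuous
    { toFun := fun ψ => (⟨fun n : ℤ => ψ (n - 1), shift_memℓp ψ⟩ : Chain N)
      map_add' := fun _ _ => rfl
      map_smul' := fun _ _ => rfl }
    1 (fun ψ => by
      rw [one_mul, lp.norm_eq_tsum_rpow (by norm_num), lp.norm_eq_tsum_rpow (by norm_num)]
      refine le_of_eq (congrArg (· ^ _) ?_)
      exact (Equiv.subRight (1 : ℤ)).tsum_eq
        (fun n : ℤ => ‖ψ n‖ ^ (2 : ENNReal).toReal))

theorem shift_apply {N : ℕ} (ψ : Chain N) (n : ℤ) : shift N ψ n = ψ (n - 1) := rfl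

/-- A switch function: `Λ n = 1` for `n` large and `Λ n = 0` for `-n` large. -/
def IsSwitch (Λ : ℤ → ℝ) : Prop :=
  (∀ᶠ n in Filter.atTop, Λ n = 1) ∧ (∀ᶠ n in Filter.atBot, Λ n = 0)

theorem IsSwitch.exists_bound {Λ : ℤ → ℝ} (h : IsSwitch Λ) : ∃ C : ℝ, ∀ n, |Λ n| ≤ C := by
  obtain ⟨a, ha⟩ := Filter.eventually_atTop.mp h.1
  obtain ⟨b, hb⟩ := Filter.eventually_atBot.mp h.2
  refine ⟨1 + ∑ n ∈ Finset.Icc b a, |Λ n|, fun n => ?_⟩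
  have h0 : 0 ≤ ∑ n ∈ Finset.Icc b a, |Λ n| := Finset.sum_nonneg fun _ _ => abs_nonneg _
  by_cases hna : a ≤ n
  · rw [ha n hna]; simpa using h0
  by_cases hnb : n ≤ b
  · rw [hb n hnb, abs_zero]; linarith
  · have hn : n ∈ Finset.Icc b a := Finset.mem_Icc.mpr ⟨by omega, by omega⟩
    have := Finset.single_le_sum (f := fun n => |Λ n|) (fun _ _ => abs_nonneg _) hn
    linarith

theorem IsSwitch.exists_norm_bound {Λ : ℤ → ℝ} (h : IsSwitch Λ) (N : ℕ) :
    ∃ C : ℝ, 0 ≤ C ∧ ∀ n,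
      ‖((Λ n : ℝ) : ℂ) • ContinuousLinearMap.id ℂ (EuclideanSpace ℂ (Fin N))‖ ≤ C := by
  obtain ⟨C, hC⟩ := h.exists_bound
  have hC0 : 0 ≤ C := (abs_nonneg _).trans (hC 0)
  refine ⟨C, hC0, fun n => ?_⟩
  rw [norm_smul, Complex.norm_real, Real.norm_eq_abs]
  calc |Λ n| * ‖ContinuousLinearMap.id ℂ (EuclideanSpace ℂ (Fin N))‖
      ≤ C * 1 := mul_le_mul (hC n) ContinuousLinearMap.norm_id_le (norm_nonneg _) hC0
    _ = C := mul_one C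

/-- The multiplication operator `(Λ ψ) n = Λ n • ψ n` on `𝒦` of a switch function. -/
def switchOp (N : ℕ) {Λ : ℤ → ℝ} (h : IsSwitch Λ) : Chain N →L[ℂ] Chain N :=
  lp.mapCLM 2 (fun n => ((Λ n : ℝ) : ℂ) • ContinuousLinearMap.id ℂ (EuclideanSpace ℂ (Fin N)))
    (h.exists_norm_bound N).choose_spec.1 (h.exists_norm_bound N).choose_spec.2

theorem switchOp_apply {N : ℕ} {Λ : ℤ → ℝ} (h : IsSwitch Λ) (ψ : Chain N) (n : ℤ) :
    switchOp N h ψ n = ((Λ n : ℝ) : ℂ) • ψ n := rfl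

/-- The same multiplication operator on `𝒦 ⊕ 𝒦`. -/
def switchOp₂ (N : ℕ) {Λ : ℤ → ℝ} (h : IsSwitch Λ) :
    WithLp 2 (Chain N × Chain N) →L[ℂ] WithLp 2 (Chain N × Chain N) :=
  blockOp (switchOp N h) 0 0 (switchOp N h)

/-- The bulk index `½ tr (Π Σ [Λ, Σ])`. -/
def bulkIndex {N : ℕ} (S : Chain N →L[ℂ] Chain N) {Λ : ℤ → ℝ} (h : IsSwitch Λ) : ℂ :=
  1 / 2 * opTrace (chirality * signHamiltonian S * ⁅switchOp₂ N h, signHamiltonian S⁆)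

/-- The block `⟨δ_n, S δ_n'⟩ : ℂ^N → ℂ^N` of an operator on `𝒦`, that is `v ↦ (S (v δ_n')) n`. -/
def block {N : ℕ} (S : Chain N →L[ℂ] Chain N) (n n' : ℤ) :
    EuclideanSpace ℂ (Fin N) →L[ℂ] EuclideanSpace ℂ (Fin N) :=
  lp.evalCLM ℂ (fun _ : ℤ => EuclideanSpace ℂ (Fin N)) 2 n ∘L S ∘L
    lp.singleContinuousLinearMap ℂ (fun _ : ℤ => EuclideanSpace ℂ (Fin N)) 2 n'

/-- `S_m = ⟨δ_m, S δ_0⟩`; for an operator that commutes with the shift,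
`⟨δ_n, S δ_n'⟩ = S_{n - n'}` for all `n`, `n'`. -/
def coeff {N : ℕ} (S : Chain N →L[ℂ] Chain N) (m : ℤ) :
    EuclideanSpace ℂ (Fin N) →L[ℂ] EuclideanSpace ℂ (Fin N) :=
  block S m 0

/-- Rapid decay: faster than every power of `|m|`. -/
def RapidDecay {V : Type*} [Norm V] (a : ℤ → V) : Prop :=
  ∀ k : ℕ, ∃ C : ℝ, ∀ m : ℤ, (1 + |(m : ℝ)|) ^ k * ‖a m‖ ≤ C

/-- The symbol `S(z) = ∑ m, S_m z ^ (-m)` on the unit circle. -/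
def symbol {N : ℕ} (S : Chain N →L[ℂ] Chain N) (z : Circle) :
    EuclideanSpace ℂ (Fin N) →L[ℂ] EuclideanSpace ℂ (Fin N) :=
  ∑' m : ℤ, (z : ℂ) ^ (-m) • coeff S m

/-- The loop `f` in `ℂ ∖ {0}` has winding number `w` around `0`: there is a continuous
logarithm `g` of `t ↦ f (e ^ (i t))` with `g (2 π) - g 0 = 2 π i w`. -/
def HasWindingNumber (f : Circle → ℂ) (w : ℤ) : Prop :=
  ∃ g : ℝ → ℂ, Continuous g ∧ (∀ t : ℝ, Complex.exp (g t) = f (Circle.exp t)) ∧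
    g (2 * Real.pi) - g 0 = 2 * Real.pi * Complex.I * w

end ChiralChain

end

noncomputable section

namespace ChiralChain

open ContinuousLinearMap
open scoped ContDiff

/-! ### Trace class criterion and basis independence of the trace -/

section TraceClass

universe u

variable {E : Type u} [NormedAddCommGroup E] [InnerProductSpace ℂ E]

/-! The map `symbolOp` turns smooth periodic matrix functions into Laurent operators and respects
products, adjoints and the unit (`symbolOp_mul`, `star_symbolOp`, `symbolOp_one`). Rapid decay makes
the symbol of `S` smooth, and `S` is its Laurent operator (`symbolOp_symbolLoop`), so questions
about `S` become pointwise questions about matrices.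

Gap: if all `S(z)` are invertible, the pointwise inverse is again smooth and yields the inverse of
`S`. Conversely, a kernel vector of some `S(z)` gives plane waves cut off to length `L`, of norm of
order `√L`, whose images under `S` stay bounded (`eq_zero_of_isUnit_laurentOp`).

Polar decomposition: it is also pointwise, because the square root of a positive invertible matrix
depends smoothly on the matrix (`contDiffAt_sqrt_comp`). Hence `U` is a Laurent operator whose
coefficients `a m` have a summable first moment. Moreover `sgn H` has off-diagonal blocks `U†` and
`U`, so `Π Σ [Λ, Σ]` is block diagonal with entries `U† [Λ, U]` and `-U [Λ, U†]`.

Trace: the commutator `[Λ, U]` has blocks `(Λ (k + m) - Λ k) a m`, and summing over `k` telescopes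
to `m`. So the trace is `∑ m tr (a m† a m)` (`tsum_inner_commutator`), which by Parseval is `-(2 π
i)⁻¹ ∫ tr (u† u')`. By Jacobi's formula this is minus the winding number of `det u`, and `det S`
differs from `det u` by a positive factor. Passing to `U†` flips the sign, so both diagonal blocks
contribute `-w`.

Trace class: the operators involved are self-adjoint with summable norms on a basis, which suffices
(`isTraceClass_of_summable_norm`). -/

theorem sum_norm_inner_mul_inner_le {ι : Type*} {b : ι → E} (hb : Orthonormal ℂ b)
    (x y : E) (s : Finset ι) :
    ∑ i ∈ s, ‖inner ℂ x (b i) * inner ℂ (b i) y‖ ≤ ‖x‖ * ‖y‖ := by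
  have hx : ∑ i ∈ s, ‖inner ℂ x (b i)‖ ^ 2 ≤ ‖x‖ ^ 2 := by
    simpa only [norm_inner_symm] using hb.sum_inner_products_le x (s := s)
  have hy : ∑ i ∈ s, ‖inner ℂ (b i) y‖ ^ 2 ≤ ‖y‖ ^ 2 := hb.sum_inner_products_le y
  calc ∑ i ∈ s, ‖inner ℂ x (b i) * inner ℂ (b i) y‖
      = ∑ i ∈ s, ‖inner ℂ x (b i)‖ * ‖inner ℂ (b i) y‖ := by simp only [norm_mul]
    _ ≤ √(∑ i ∈ s, ‖inner ℂ x (b i)‖ ^ 2) * √(∑ i ∈ s, ‖inner ℂ (b i) y‖ ^ 2) :=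
        Real.sum_mul_le_sqrt_mul_sqrt _ _ _
    _ ≤ √(‖x‖ ^ 2) * √(‖y‖ ^ 2) := by gcongr
    _ = ‖x‖ * ‖y‖ := by rw [Real.sqrt_sq (norm_nonneg _), Real.sqrt_sq (norm_nonneg _)]

/-- Bessel bounds the sum over `b` by `‖Y (e j)‖`. Absolute summability over both bases justifies
the interchange of sums in `hasSum_inner_of_summable_norm`. -/
theorem summable_prod_inner_mul_inner {ι κ : Type*} (e : HilbertBasis κ ℂ E)
    (b : HilbertBasis ι ℂ E) {Y : E →L[ℂ] E} (hY : Summable fun j => ‖Y (e j)‖) :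
    Summable fun p : κ × ι => ‖inner ℂ (e p.1) (b p.2) * inner ℂ (b p.2) (Y (e p.1))‖ := by
  have key (j : κ) (s : Finset ι) :
      ∑ i ∈ s, ‖inner ℂ (e j) (b i) * inner ℂ (b i) (Y (e j))‖ ≤ ‖Y (e j)‖ := by
    simpa [e.orthonormal.1 j] using sum_norm_inner_mul_inner_le b.orthonormal (e j) (Y (e j)) s
  have hs (j : κ) : Summable fun i => ‖inner ℂ (e j) (b i) * inner ℂ (b i) (Y (e j))‖ :=
    summable_of_sum_le (fun _ => norm_nonneg _) (key j)
  refine (summable_prod_of_nonneg fun _ => norm_nonneg _).2 ⟨hs, ?_⟩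
  exact hY.of_nonneg_of_le (fun j => tsum_nonneg fun _ => norm_nonneg _)
    fun j => (hs j).tsum_le_of_sum_le (key j)

theorem hasSum_inner_basis_expansion {ι κ : Type*} (e : HilbertBasis κ ℂ E)
    (b : HilbertBasis ι ℂ E) (Y : E →L[ℂ] E) (i : ι) :
    HasSum (fun j => inner ℂ (e j) (b i) * inner ℂ (b i) (Y (e j))) (inner ℂ (b i) (Y (b i))) := by
  have h := (e.hasSum_repr (b i)).mapL ((innerSL ℂ (b i)).comp Y)
  simpa [e.repr_apply_apply] using h

/-- The diagonal sum of an operator that maps some Hilbert basis to a summable family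
does not depend on the basis. -/
theorem hasSum_inner_of_summable_norm {ι κ : Type*} (e : HilbertBasis κ ℂ E)
    (b : HilbertBasis ι ℂ E) {Y : E →L[ℂ] E} (hY : Summable fun j => ‖Y (e j)‖) :
    HasSum (fun i => inner ℂ (b i) (Y (b i))) (∑' j, inner ℂ (e j) (Y (e j))) := by
  have hs := (summable_prod_inner_mul_inner e b hY).of_norm
  have h1 : ∑' p : κ × ι, inner ℂ (e p.1) (b p.2) * inner ℂ (b p.2) (Y (e p.1)) =
      ∑' j, inner ℂ (e j) (Y (e j)) := by
    rw [hs.tsum_prod]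
    exact tsum_congr fun j => (b.hasSum_inner_mul_inner (e j) (Y (e j))).tsum_eq
  rw [← h1]
  have h2 := (Equiv.prodComm ι κ).hasSum_iff.2 hs.hasSum
  exact h2.prod_fiberwise fun i => hasSum_inner_basis_expansion e b Y i

/-- The same double sum with absolute values. The right-hand side does not grow when `Y` is
multiplied on the left by a contraction. -/
theorem sum_norm_inner_le_tsum {ι κ : Type*} (e : HilbertBasis κ ℂ E)
    (b : HilbertBasis ι ℂ E) {Y : E →L[ℂ] E} (hY : Summable fun j => ‖Y (e j)‖) (s : Finset ι) :
    ∑ i ∈ s, ‖inner ℂ (b i) (Y (b i))‖ ≤ ∑' j, ‖Y (e j)‖ := by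
  have hs := summable_prod_inner_mul_inner e b hY
  have h2 (i : ι) : Summable fun j => ‖inner ℂ (e j) (b i) * inner ℂ (b i) (Y (e j))‖ :=
    ((Equiv.prodComm ι κ).summable_iff.2 hs).prod_factor i
  calc ∑ i ∈ s, ‖inner ℂ (b i) (Y (b i))‖
      ≤ ∑ i ∈ s, ∑' j, ‖inner ℂ (e j) (b i) * inner ℂ (b i) (Y (e j))‖ := by
        refine Finset.sum_le_sum fun i _ => ?_
        rw [← (hasSum_inner_basis_expansion e b Y i).tsum_eq]
        exact norm_tsum_le_tsum_norm (h2 i)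
    _ = ∑' j, ∑ i ∈ s, ‖inner ℂ (e j) (b i) * inner ℂ (b i) (Y (e j))‖ :=
        (Summable.tsum_finsetSum fun i _ => h2 i).symm
    _ ≤ ∑' j, ‖Y (e j)‖ := by
        refine (summable_sum fun i _ => h2 i).tsum_le_tsum (fun j => ?_) hY
        simpa [e.orthonormal.1 j] using
          sum_norm_inner_mul_inner_le b.orthonormal (e j) (Y (e j)) s

variable [CompleteSpace E]

/-- A self-adjoint `X` is approximated in the following sense by contractions times `X`:
they converge in norm to `|X|`. -/
theorem exists_contraction_norm_mul_sub_abs_le {X : E →L[ℂ] E} (hX : IsSelfAdjoint X) {ε : ℝ}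
    (hε : 0 < ε) : ∃ W : E →L[ℂ] E, ‖W‖ ≤ 1 ∧ ‖W * X - CFC.abs X‖ ≤ ε := by
  have hpos (x : ℝ) : 0 < |x| + ε := by positivity
  have hc : Continuous fun x : ℝ => x / (|x| + ε) :=
    continuous_id.div (by fun_prop) fun x => (hpos x).ne'
  -- A continuous substitute for the sign: multiplied by `x` it misses `|x|` by `|x| ε / (|x| + ε) ≤
  -- ε`.
  refine ⟨cfc (fun x : ℝ => x / (|x| + ε)) X, ?_, ?_⟩
  · refine norm_cfc_le zero_le_one fun x _ => ?_
    rw [norm_div, Real.norm_eq_abs, Real.norm_eq_abs, abs_of_pos (hpos x)]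
    exact (div_le_one (hpos x)).2 (by linarith)
  · have h1 : cfc (fun x : ℝ => x / (|x| + ε)) X * X - CFC.abs X =
        cfc (fun x : ℝ => x / (|x| + ε) * x - ‖x‖) X := by
      rw [cfc_sub (fun x : ℝ => x / (|x| + ε) * x) (fun x => ‖x‖) X
          (hc.mul continuous_id).continuousOn (by fun_prop),
        cfc_mul (fun x : ℝ => x / (|x| + ε)) (fun x => x) X hc.continuousOn (by fun_prop),
        cfc_id' ℝ X, CFC.abs_eq_cfc_norm X]
    rw [h1]
    refine norm_cfc_le hε.le fun x _ => ?_
    have h2 : x / (|x| + ε) * x - ‖x‖ = -(|x| * ε / (|x| + ε)) := by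
      have := (hpos x).ne'
      rw [Real.norm_eq_abs]
      field_simp
      nlinarith [sq_abs x]
    rw [h2, norm_neg, Real.norm_eq_abs, abs_of_nonneg (by positivity), div_le_iff₀ (hpos x)]
    nlinarith [abs_nonneg x]

/-- `|X|` is a norm limit of operators `W * X` with contractions `W`, and the diagonal sums of all
of these are bounded by `∑ ‖X (e j)‖`. -/
theorem isTraceClass_of_summable_norm {κ : Type*} (e : HilbertBasis κ ℂ E) {X : E →L[ℂ] E}
    (hX : IsSelfAdjoint X) (hs : Summable fun j => ‖X (e j)‖) : IsTraceClass X := by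
  intro ι b
  have hnn (i : ι) : 0 ≤ (inner ℂ (b i) (CFC.abs X (b i))).re := by
    have := ((nonneg_iff_isPositive _).1 (CFC.abs_nonneg X)).re_inner_nonneg_right (b i)
    simpa using this
  refine summable_of_sum_le hnn (c := ∑' j, ‖X (e j)‖) fun s => ?_
  refine le_of_forall_pos_le_add fun δ hδ => ?_
  -- The errors over the diagonal entries in `s` add up to at most `δ`; the `+ 1` covers empty `s`.
  have hε : 0 < δ / (s.card + 1) := by positivity
  obtain ⟨W, hW, hWX⟩ := exists_contraction_norm_mul_sub_abs_le hX hε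
  have hle (j : κ) : ‖(W * X) (e j)‖ ≤ ‖X (e j)‖ := by
    simpa using W.le_of_opNorm_le hW (X (e j))
  have hs' : Summable fun j => ‖(W * X) (e j)‖ := hs.of_nonneg_of_le (fun _ => norm_nonneg _) hle
  have hterm (i : ι) : (inner ℂ (b i) (CFC.abs X (b i))).re ≤
      ‖inner ℂ (b i) ((W * X) (b i))‖ + δ / (s.card + 1) := by
    have h1 : inner ℂ (b i) (CFC.abs X (b i)) =
        inner ℂ (b i) ((W * X) (b i)) - inner ℂ (b i) ((W * X - CFC.abs X) (b i)) := by
      rw [← inner_sub_right]; simp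
    calc (inner ℂ (b i) (CFC.abs X (b i))).re ≤ ‖inner ℂ (b i) (CFC.abs X (b i))‖ :=
          Complex.re_le_norm _
      _ ≤ ‖inner ℂ (b i) ((W * X) (b i))‖ + ‖inner ℂ (b i) ((W * X - CFC.abs X) (b i))‖ := by
          rw [h1]; exact norm_sub_le _ _
      _ ≤ _ := by
          gcongr
          refine (norm_inner_le_norm _ _).trans ?_
          rw [b.orthonormal.1 i, one_mul]
          simpa [b.orthonormal.1 i] using (W * X - CFC.abs X).le_of_opNorm_le hWX (b i)
  calc ∑ i ∈ s, (inner ℂ (b i) (CFC.abs X (b i))).re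
      ≤ ∑ i ∈ s, (‖inner ℂ (b i) ((W * X) (b i))‖ + δ / (s.card + 1)) :=
        Finset.sum_le_sum fun i _ => hterm i
    _ = ∑ i ∈ s, ‖inner ℂ (b i) ((W * X) (b i))‖ + s.card * (δ / (s.card + 1)) := by
        rw [Finset.sum_add_distrib, Finset.sum_const, nsmul_eq_mul]
    _ ≤ ∑' j, ‖X (e j)‖ + δ := by
        refine add_le_add ((sum_norm_inner_le_tsum e b hs' s).trans
          (hs'.tsum_le_tsum hle hs)) ?_
        rw [mul_div_assoc', div_le_iff₀ (by positivity)]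
        nlinarith

theorem opTrace_eq_tsum {κ : Type*} (e : HilbertBasis κ ℂ E) {X : E →L[ℂ] E}
    (hs : Summable fun j => ‖X (e j)‖) : opTrace X = ∑' j, inner ℂ (e j) (X (e j)) :=
  (hasSum_inner_of_summable_norm e (exists_hilbertBasis ℂ E).choose_spec.choose hs).tsum_eq

/-- The Hilbert basis of `E ⊕ E` consisting of a Hilbert basis of each summand. -/
theorem exists_hilbertBasis_prod {κ : Type*} (e : HilbertBasis κ ℂ E) :
    ∃ b : HilbertBasis (κ ⊕ κ) ℂ (WithLp 2 (E × E)),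
      (∀ j, b (Sum.inl j) = WithLp.toLp 2 (e j, 0)) ∧
      (∀ j, b (Sum.inr j) = WithLp.toLp 2 (0, e j)) := by
  classical
  let v : κ ⊕ κ → WithLp 2 (E × E) :=
    Sum.elim (fun j => WithLp.toLp 2 (e j, 0)) (fun j => WithLp.toLp 2 (0, e j))
  have hv : Orthonormal ℂ v := by
    rw [orthonormal_iff_ite]
    have he := orthonormal_iff_ite.1 e.orthonormal
    rintro (i | i) (j | j) <;> simp [v, he]
  have hspan : (Submodule.span ℂ (Set.range v))ᗮ = ⊥ := by
    rw [Submodule.eq_bot_iff]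
    intro x hx
    have h0 (k : κ ⊕ κ) : inner ℂ (v k) x = 0 :=
      (Submodule.mem_orthogonal _ _).1 hx _ (Submodule.subset_span ⟨k, rfl⟩)
    have hrep (y : E) (hy : ∀ j, inner ℂ (e j) y = 0) : y = 0 := by
      have := e.hasSum_repr y
      simp only [e.repr_apply_apply, hy, zero_smul] at this
      exact this.unique hasSum_zero
    refine WithLp.ofLp_injective 2 (Prod.ext (hrep _ fun j => ?_) (hrep _ fun j => ?_))
    · simpa [v] using h0 (Sum.inl j)
    · simpa [v] using h0 (Sum.inr j)
  refine ⟨HilbertBasis.mkOfOrthogonalEqBot hv hspan, fun j => ?_, fun j => ?_⟩ <;> simp [v]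

end TraceClass

/-! ### Block operators, polar decomposition and the sign of the Hamiltonian -/

section TraceClass

universe u

variable {E : Type u} [NormedAddCommGroup E] [InnerProductSpace ℂ E]

theorem blockOp_apply (A B C D : E →L[ℂ] E) (x : WithLp 2 (E × E)) :
    blockOp A B C D x = WithLp.toLp 2 (A x.fst + B x.snd, C x.fst + D x.snd) := rfl

theorem blockOp_mul (A B C D A' B' C' D' : E →L[ℂ] E) :
    blockOp A B C D * blockOp A' B' C' D' =
      blockOp (A * A' + B * C') (A * B' + B * D') (C * A' + D * C') (C * B' + D * D') := by
  ext x : 1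
  refine WithLp.ofLp_injective 2 (Prod.ext ?_ ?_) <;> simp [blockOp_apply] <;> abel

theorem blockOp_one : blockOp (1 : E →L[ℂ] E) 0 0 1 = 1 := by
  ext x : 1
  simp [blockOp_apply]
  rfl

theorem blockOp_sub (A B C D A' B' C' D' : E →L[ℂ] E) :
    blockOp A B C D - blockOp A' B' C' D' = blockOp (A - A') (B - B') (C - C') (D - D') := by
  ext x : 1
  refine WithLp.ofLp_injective 2 (Prod.ext ?_ ?_) <;> simp [blockOp_apply] <;> abel

variable [CompleteSpace E]

theorem IsPolarUnitary.isUnit_abs {S U : E →L[ℂ] E} (h : IsPolarUnitary S U) (hS : IsUnit S) :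
    IsUnit (CFC.abs S) := by
  rw [h.2] at hS
  exact ((Unitary.toUnits ⟨U, h.1⟩).isUnit_units_mul (CFC.abs S)).1 hS

theorem IsPolarUnitary.unique {S U U' : E →L[ℂ] E} (hS : IsUnit S) (h : IsPolarUnitary S U)
    (h' : IsPolarUnitary S U') : U = U' :=
  (h.isUnit_abs hS).mul_left_injective (h.2.symm.trans h'.2)

/-- Uniqueness of the positive square root. Presenting the candidate as `star q * q` makes its
positivity automatic, so only algebraic identities remain to be checked. -/
theorem abs_eq_of_star_mul_self_mul_self {S q : E →L[ℂ] E}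
    (h : star q * q * (star q * q) = star S * S) : CFC.abs S = star q * q :=
  CFC.sqrt_unique h (star_mul_self_nonneg q)

theorem isPolarUnitary_of_star_mul_self {S U q : E →L[ℂ] E} (hU : star U * U = 1)
    (hU' : U * star U = 1) (hq : star q * q * (star q * q) = star S * S)
    (hS : S = U * (star q * q)) : IsPolarUnitary S U :=
  ⟨Unitary.mem_iff.2 ⟨hU, hU'⟩, by rwa [abs_eq_of_star_mul_self_mul_self hq]⟩

theorem star_blockOp (A B C D : E →L[ℂ] E) :
    star (blockOp A B C D) = blockOp (star A) (star C) (star B) (star D) := by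
  refine ((eq_adjoint_iff _ _).2 fun x y => ?_).symm
  simp only [blockOp_apply, WithLp.prod_inner_apply, inner_add_left, inner_add_right,
    star_eq_adjoint, adjoint_inner_left]
  simp only [WithLp.fst, WithLp.snd]
  ring

theorem hamiltonian_eq (S : E →L[ℂ] E) : hamiltonian S = blockOp 0 (star S) S 0 := rfl

theorem isSelfAdjoint_hamiltonian (S : E →L[ℂ] E) : IsSelfAdjoint (hamiltonian S) := by
  rw [hamiltonian_eq, IsSelfAdjoint, star_blockOp]; simp

theorem isUnit_hamiltonian_iff {S : E →L[ℂ] E} : IsUnit (hamiltonian S) ↔ IsUnit S := by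
  rw [hamiltonian_eq]
  constructor
  · intro h
    rw [isUnit_iff_bijective] at h ⊢
    constructor
    · intro x y hxy
      have := @h.1 (WithLp.toLp 2 (x, 0)) (WithLp.toLp 2 (y, 0)) (by simp [blockOp_apply, hxy])
      simpa using congrArg WithLp.fst this
    · intro y
      obtain ⟨x, hx⟩ := h.2 (WithLp.toLp 2 (0, y))
      exact ⟨x.fst, by simpa [blockOp_apply] using congrArg WithLp.snd hx⟩
  · rintro ⟨u, rfl⟩
    refine isUnit_iff_exists.2 ⟨blockOp 0 (↑u⁻¹ : E →L[ℂ] E) (star (↑u⁻¹ : E →L[ℂ] E)) 0, ?_, ?_⟩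
    all_goals
      rw [blockOp_mul, ← blockOp_one]
      simp [← star_mul]

theorem zero_notMem_spectrum_hamiltonian_iff {S : E →L[ℂ] E} :
    0 ∉ spectrum ℂ (hamiltonian S) ↔ IsUnit S := by
  rw [spectrum.zero_notMem_iff, isUnit_hamiltonian_iff]

/-- The sign of an invertible self-adjoint operator is the unitary factor of its
polar decomposition. -/
theorem cfc_sign_eq {H J R : E →L[ℂ] E} (hsa : IsSelfAdjoint H) (hu : IsUnit H)
    (hR : star R * R * (star R * R) = star H * H) (hJ : H = J * (star R * R)) :
    cfc Real.sign H = J := by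
  have habs := abs_eq_of_star_mul_self_mul_self hR
  have hunit : IsUnit (star R * R) := by
    have h2 : IsUnit (star R * R * (star R * R)) := by
      rw [hR, hsa.star_eq]; exact hu.mul hu
    exact ((Commute.refl _).isUnit_mul_iff.1 h2).1
  -- Multiplied on the right by the invertible `|H|`, both sides become `H`, since `sgn x * |x| =
  -- x`.
  refine hunit.mul_left_injective (?_ : _ * _ = _ * _)
  rw [← hJ, ← habs]
  have h0 : (0 : ℝ) ∉ spectrum ℝ H := (spectrum.zero_notMem_iff ℝ).2 hu
  have hc : ContinuousOn Real.sign (spectrum ℝ H) := by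
    intro x hx
    refine ContinuousAt.continuousWithinAt ?_
    have hne : x ≠ 0 := fun h => h0 (h ▸ hx)
    rcases lt_or_gt_of_ne hne with hx0 | hx0
    · refine (continuousAt_const (y := (-1 : ℝ))).congr ?_
      filter_upwards [Iio_mem_nhds hx0] with y hy using (Real.sign_of_neg hy).symm
    · refine (continuousAt_const (y := (1 : ℝ))).congr ?_
      filter_upwards [Ioi_mem_nhds hx0] with y hy using (Real.sign_of_pos hy).symm
  rw [CFC.abs_eq_cfc_norm H hsa, ← cfc_mul Real.sign (fun x => ‖x‖) _ hc (by fun_prop)]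
  conv_rhs => rw [← cfc_id' ℝ H hsa]
  refine cfc_congr fun x _ => ?_
  simp only [Real.norm_eq_abs]
  rcases lt_trichotomy x 0 with hx | rfl | hx
  · rw [Real.sign_of_neg hx, abs_of_neg hx]; ring
  · simp
  · rw [Real.sign_of_pos hx, abs_of_pos hx]; ring

/-- With `P = |S|`, the modulus of `H` is the diagonal block operator with entries `P` and `U P U†`.
It equals `R† R` for `R` with entries `√P` and `√P U†`. -/
theorem signHamiltonian_eq {S U : E →L[ℂ] E} (hS : IsUnit S) (h : IsPolarUnitary S U) :
    signHamiltonian S = blockOp 0 (star U) U 0 := by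
  have hU1 : star U * U = 1 := (Unitary.mem_iff.1 h.1).1
  have hP0 := CFC.abs_nonneg S
  have hSP := h.2
  have e1 : star S * S = CFC.abs S * CFC.abs S := (CFC.abs_mul_abs S).symm
  generalize CFC.abs S = P at hP0 hSP e1
  have hPsa : star P = P := (IsSelfAdjoint.of_nonneg hP0).star_eq
  obtain ⟨q, hqsa, hqq⟩ : ∃ q, star q = q ∧ q * q = P :=
    ⟨CFC.sqrt P, (IsSelfAdjoint.of_nonneg (CFC.sqrt_nonneg P)).star_eq, CFC.sqrt_mul_sqrt_self P⟩
  have hR : star (blockOp q 0 0 (q * star U)) * blockOp q 0 0 (q * star U) =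
      blockOp P 0 0 (U * P * star U) := by
    rw [star_blockOp, blockOp_mul]
    simp [hqsa, ← hqq, mul_assoc]
  refine cfc_sign_eq (isSelfAdjoint_hamiltonian S) (isUnit_hamiltonian_iff.2 hS)
    (R := blockOp q 0 0 (q * star U)) ?_ ?_
  · rw [hR, (isSelfAdjoint_hamiltonian S).star_eq, hamiltonian_eq, blockOp_mul, blockOp_mul]
    have e2 : S * star S = U * P * star U * (U * P * star U) := by
      rw [hSP, star_mul, hPsa]
      simp only [mul_assoc]
      rw [← mul_assoc (star U) U, hU1, one_mul]
    simp [e1, e2]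
  · rw [hR, hamiltonian_eq, blockOp_mul]
    have e1 : star S = P * star U := by rw [hSP, star_mul, hPsa]
    have e2 : star U * (U * P * star U) = P * star U := by
      simp only [← mul_assoc, hU1, one_mul]
    rw [e1, e2, hSP]
    simp

theorem chirality_mul_signHamiltonian_mul_commutator {S U Λ : E →L[ℂ] E} (hS : IsUnit S)
    (h : IsPolarUnitary S U) :
    chirality * signHamiltonian S * ⁅blockOp Λ 0 0 Λ, signHamiltonian S⁆ =
      blockOp (star U * ⁅Λ, U⁆) 0 0 (-(U * ⁅Λ, star U⁆)) := by
  rw [signHamiltonian_eq hS h, chirality]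
  simp [Ring.lie_def, blockOp_mul, blockOp_sub]

end TraceClass

/-! ### Fourier series of smooth loops in a Banach space -/

section Fourier

variable {F : Type*} [NormedAddCommGroup F] [NormedSpace ℂ F]

/-- The character `t ↦ e ^ (i m t)` of period `2 π`. -/
def character (m : ℤ) (t : ℝ) : ℂ := Complex.exp (m * t * Complex.I)

theorem character_eq_zpow (m : ℤ) (t : ℝ) : character m t = ((Circle.exp t : Circle) : ℂ) ^ m := by
  rw [character, Circle.coe_exp, ← Complex.exp_int_mul, mul_assoc]

theorem character_add (k m : ℤ) (t : ℝ) : character (k + m) t = character k t * character m t := by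
  rw [character, character, character, ← Complex.exp_add]; push_cast; ring_nf

theorem character_zero (t : ℝ) : character 0 t = 1 := by simp [character]

theorem norm_character (m : ℤ) (t : ℝ) : ‖character m t‖ = 1 := by
  rw [character_eq_zpow]; simp

theorem star_character (m : ℤ) (t : ℝ) : star (character m t) = character (-m) t := by
  rw [character, character, Complex.star_def, ← Complex.exp_conj]
  simp

theorem character_periodic (m : ℤ) : Function.Periodic (character m) (2 * Real.pi) := by
  intro t
  rw [character_eq_zpow, character_eq_zpow, Circle.periodic_exp t]

theorem hasDerivAt_character (m : ℤ) (t : ℝ) :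
    HasDerivAt (character m) (m * Complex.I * character m t) t := by
  have h : HasDerivAt (fun t : ℝ => (m : ℂ) * (t : ℂ) * Complex.I) ((m : ℂ) * 1 * Complex.I) t :=
    ((Complex.ofRealCLM.hasDerivAt (x := t)).const_mul (m : ℂ)).mul_const Complex.I
  exact h.cexp.congr_deriv (by simp only [character]; ring)

theorem contDiff_character (m : ℤ) : ContDiff ℝ ∞ (character m) := by
  have h : ContDiff ℝ ∞ fun t : ℝ => (m : ℂ) * (t : ℂ) * Complex.I :=
    (contDiff_const.mul Complex.ofRealCLM.contDiff).mul contDiff_const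
  exact h.cexp

theorem continuous_character (m : ℤ) : Continuous (character m) := (contDiff_character m).continuous

theorem integral_character (m : ℤ) :
    ∫ t in (0 : ℝ)..2 * Real.pi, character m t = if m = 0 then 2 * Real.pi else 0 := by
  split_ifs with h
  · subst h; simp [character_zero]
  · have hne : (m : ℂ) * Complex.I ≠ 0 := mul_ne_zero (by exact_mod_cast h) Complex.I_ne_zero
    have hd (t : ℝ) : HasDerivAt (fun t => (m * Complex.I : ℂ)⁻¹ * character m t)
        (character m t) t := by
      exact ((hasDerivAt_character m t).const_mul (m * Complex.I : ℂ)⁻¹).congr_deriv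
        (inv_mul_cancel_left₀ hne _)
    rw [intervalIntegral.integral_eq_sub_of_hasDerivAt (fun t _ => hd t)
      ((continuous_character m).intervalIntegrable _ _)]
    have := character_periodic m 0
    rw [zero_add] at this
    simp [this]

/-- The `m`-th coefficient `(1 / 2 π) ∫ e ^ (i m t) f t` in `f t = ∑ m, f_m e ^ (- i m t)`. -/
def loopCoeff (f : ℝ → F) (m : ℤ) : F :=
  (2 * Real.pi : ℂ)⁻¹ • ∫ t in (0 : ℝ)..2 * Real.pi, character m t • f t

theorem norm_loopCoeff_le {f : ℝ → F} {C : ℝ} (hf : ∀ t, ‖f t‖ ≤ C) (m : ℤ) :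
    ‖loopCoeff f m‖ ≤ C := by
  have hpi := Real.two_pi_pos
  have h := intervalIntegral.norm_integral_le_of_norm_le_const (a := 0) (b := 2 * Real.pi)
    (f := fun t => character m t • f t) (C := C)
    fun t _ => by rw [norm_smul, norm_character, one_mul]; exact hf t
  rw [sub_zero, abs_of_pos hpi] at h
  rw [loopCoeff, norm_smul, norm_inv]
  have h2 : ‖(2 * Real.pi : ℂ)‖ = 2 * Real.pi := by
    rw [← Complex.ofReal_ofNat, ← Complex.ofReal_mul, Complex.norm_real, Real.norm_eq_abs,
      abs_of_pos hpi]
  rw [h2, inv_mul_le_iff₀ hpi]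
  linarith

theorem clm_loopCoeff [CompleteSpace F] {G : Type*} [NormedAddCommGroup G] [NormedSpace ℂ G]
    [CompleteSpace G] (φ : F →L[ℂ] G) {f : ℝ → F} (hf : Continuous f) (m : ℤ) :
    φ (loopCoeff f m) = loopCoeff (fun t => φ (f t)) m := by
  have hc : Continuous fun t => character m t • f t := (continuous_character m).smul hf
  rw [loopCoeff, map_smul, ← φ.intervalIntegral_comp_comm (hc.intervalIntegrable _ _)]
  simp [loopCoeff]

/-- Termwise integration and orthogonality of characters. This is uniqueness of Fourier coefficients
for absolutely convergent series. -/
theorem loopCoeff_tsum [CompleteSpace F] {a : ℤ → F} (ha : Summable fun m => ‖a m‖) (m : ℤ) :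
    loopCoeff (fun t => ∑' k, character (-k) t • a k) m = a m := by
  have hpi : (2 * Real.pi : ℂ) ≠ 0 := by exact_mod_cast Real.two_pi_pos.ne'
  let g (k : ℤ) : C(ℝ, F) :=
    ⟨fun t => character (m - k) t • a k, (continuous_character _).smul continuous_const⟩
  have hg (k : ℤ) (K : TopologicalSpace.Compacts ℝ) : ‖(g k).restrict K‖ ≤ ‖a k‖ := by
    refine (ContinuousMap.norm_le _ (norm_nonneg _)).2 fun t => ?_
    change ‖character (m - k) t • a k‖ ≤ ‖a k‖
    rw [norm_smul, norm_character, one_mul]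
  have h := intervalIntegral.hasSum_intervalIntegral_of_summable_norm (a := 0)
    (b := 2 * Real.pi) (f := g)
    (ha.of_nonneg_of_le (fun _ => norm_nonneg _) fun k => hg k _)
  have h1 (t : ℝ) : character m t • ∑' k, character (-k) t • a k = ∑' k, g k t := by
    have hs : Summable fun k => character (-k) t • a k :=
      .of_norm (by simpa [norm_smul, norm_character] using ha)
    rw [← hs.tsum_const_smul]
    refine tsum_congr fun k => ?_
    simp only [g, ContinuousMap.coe_mk]
    rw [sub_eq_add_neg, character_add, mul_smul]
  have h2 (k : ℤ) : ∫ t in (0 : ℝ)..2 * Real.pi, g k t =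
      if k = m then (2 * Real.pi : ℂ) • a m else 0 := by
    simp only [g, ContinuousMap.coe_mk]
    rw [intervalIntegral.integral_smul_const, integral_character]
    by_cases hk : k = m
    · subst hk; simp
    · rw [if_neg (sub_ne_zero.2 (Ne.symm hk)), if_neg hk]; simp
  rw [loopCoeff]
  simp only [h1]
  rw [← h.tsum_eq]
  simp only [h2, tsum_ite_eq]
  rw [smul_smul, inv_mul_cancel₀ hpi, one_smul]

/-- A smooth `2 π`-periodic function. -/
structure IsSmoothLoop (f : ℝ → F) : Prop where
  contDiff : ContDiff ℝ ∞ f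
  periodic : Function.Periodic f (2 * Real.pi)

namespace IsSmoothLoop

variable {f g : ℝ → F}

theorem continuous (hf : IsSmoothLoop f) : Continuous f := hf.contDiff.continuous

theorem hasDerivAt (hf : IsSmoothLoop f) (t : ℝ) : HasDerivAt f (deriv f t) t :=
  ((hf.contDiff.differentiable (by simp)) t).hasDerivAt

theorem deriv (hf : IsSmoothLoop f) : IsSmoothLoop (deriv f) where
  contDiff := (contDiff_infty_iff_deriv.1 hf.contDiff).2
  periodic t := by
    rw [← deriv_comp_add_const]
    congr 1
    exact funext hf.periodic

theorem exists_norm_le (hf : IsSmoothLoop f) : ∃ C, ∀ t, ‖f t‖ ≤ C := by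
  obtain ⟨C, hC⟩ := (hf.periodic.isBounded_of_continuous Real.two_pi_pos.ne'
    hf.continuous).exists_norm_le
  exact ⟨C, fun t => hC _ ⟨t, rfl⟩⟩

theorem clm_apply {G : Type*} [NormedAddCommGroup G] [NormedSpace ℂ G] (φ : F →L[ℂ] G)
    (hf : IsSmoothLoop f) : IsSmoothLoop fun t => φ (f t) where
  contDiff := (φ.restrictScalars ℝ).contDiff.comp hf.contDiff
  periodic t := by simp [hf.periodic t]

variable [CompleteSpace F]

/-- Integration by parts; periodicity removes the boundary term. -/
theorem loopCoeff_deriv (hf : IsSmoothLoop f) (m : ℤ) :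
    loopCoeff (_root_.deriv f) m = -(m * Complex.I) • loopCoeff f m := by
  have hd (t : ℝ) := (hasDerivAt_character m t).smul (hf.hasDerivAt t)
  have hi1 : Continuous fun t => character m t • _root_.deriv f t :=
    (continuous_character m).smul hf.deriv.continuous
  have hi2 : Continuous fun t => (m * Complex.I * character m t) • f t :=
    (continuous_const.mul (continuous_character m)).smul hf.continuous
  have h := intervalIntegral.integral_eq_sub_of_hasDerivAt (a := 0) (b := 2 * Real.pi)
    (fun t _ => hd t) ((hi1.add hi2).intervalIntegrable _ _)
  have p1 := character_periodic m 0
  have p2 := hf.periodic 0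
  rw [zero_add] at p1 p2
  simp only [Pi.smul_apply', p1, p2, sub_self] at h
  rw [intervalIntegral.integral_add (hi1.intervalIntegrable _ _) (hi2.intervalIntegrable _ _)] at h
  simp only [mul_smul _ (character m _)] at h
  rw [intervalIntegral.integral_smul] at h
  rw [loopCoeff, loopCoeff, eq_neg_of_add_eq_zero_left h, smul_neg, neg_smul, smul_comm]

/-- Two derivatives give coefficients of order `m⁻²`. -/
theorem summable_norm_loopCoeff (hf : IsSmoothLoop f) : Summable fun m => ‖loopCoeff f m‖ := by
  obtain ⟨C, hC⟩ := hf.deriv.deriv.exists_norm_le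
  have hb (m : ℤ) : (m : ℝ) ^ 2 * ‖loopCoeff f m‖ ≤ C := by
    have h := norm_loopCoeff_le hC m
    rw [hf.deriv.loopCoeff_deriv, hf.loopCoeff_deriv, norm_smul, norm_smul] at h
    have : ‖-(m * Complex.I)‖ = |(m : ℝ)| := by simp
    rw [this, ← mul_assoc, ← sq, sq_abs] at h
    exact h
  refine Summable.of_norm_bounded_eventually
    ((Real.summable_one_div_int_pow (p := 2)).2 one_lt_two |>.mul_left C) ?_
  filter_upwards [(Set.finite_singleton (0 : ℤ)).compl_mem_cofinite] with m (hm : m ≠ 0)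
  have hm2 : 0 < (m : ℝ) ^ 2 := by positivity
  rw [norm_norm, mul_one_div, le_div_iff₀ hm2, mul_comm]
  exact hb m

/-- These are the norms of the coefficients of the derivative. The first moment controls both the
plane wave estimate and the commutator with a switch function. -/
theorem summable_abs_mul_norm_loopCoeff (hf : IsSmoothLoop f) :
    Summable fun m : ℤ => |(m : ℝ)| * ‖loopCoeff f m‖ := by
  refine hf.deriv.summable_norm_loopCoeff.congr fun m => ?_
  rw [hf.loopCoeff_deriv, norm_smul]
  simp

theorem hasSum_scalar {f : ℝ → ℂ} (hf : IsSmoothLoop f) (t : ℝ) :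
    HasSum (fun m => character (-m) t • loopCoeff f m) (f t) := by
  have : Fact (0 < 2 * Real.pi) := ⟨Real.two_pi_pos⟩
  let F : C(AddCircle (2 * Real.pi), ℂ) :=
    ⟨hf.periodic.lift, hf.continuous.quotient_lift _⟩
  have hF (x : ℝ) : F x = f x := hf.periodic.lift_coe x
  have hfour (m : ℤ) (x : ℝ) : fourier m (x : AddCircle (2 * Real.pi)) = character m x := by
    rw [fourier_coe_apply, character]
    congr 1
    have : (Real.pi : ℂ) ≠ 0 := by exact_mod_cast Real.pi_ne_zero
    push_cast
    field_simp
  have hcoeff (m : ℤ) : fourierCoeff F m = loopCoeff f (-m) := by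
    rw [fourierCoeff_eq_intervalIntegral F m 0, loopCoeff, zero_add, ← Complex.coe_smul]
    simp [hF, hfour]
  have hsum : Summable (fourierCoeff F) := by
    simp only [funext hcoeff]
    exact ((Equiv.neg ℤ).summable_iff (f := loopCoeff f)).2 hf.summable_norm_loopCoeff.of_norm
  have h := has_pointwise_sum_fourier_series_of_summable hsum (t : AddCircle (2 * Real.pi))
  rw [hF] at h
  -- The usual Fourier convention has the opposite sign in the exponent, hence the reflection of the
  -- index.
  rw [← (Equiv.neg ℤ).hasSum_iff]
  convert h using 2 with m
  simp [hcoeff, hfour, mul_comm]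

/-- The series converges absolutely, and continuous functionals separate points, so the scalar case
identifies its sum. -/
theorem hasSum (hf : IsSmoothLoop f) (t : ℝ) :
    HasSum (fun m => character (-m) t • loopCoeff f m) (f t) := by
  have hs : Summable fun m => character (-m) t • loopCoeff f m :=
    .of_norm (by simpa [norm_smul, norm_character] using hf.summable_norm_loopCoeff)
  convert hs.hasSum
  refine (SeparatingDual.eq_iff_forall_dual_eq (R := ℂ)).2 fun φ => ?_
  have h1 := (hf.clm_apply φ).hasSum_scalar t
  have h2 := hs.hasSum.mapL φ
  simp only [map_smul, clm_loopCoeff φ hf.continuous] at h2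
  exact h1.unique h2

end IsSmoothLoop

end Fourier

/-! ### Convolution -/

section Convolution

variable {M B : Type*} [NormedRing M]

/-- The convolution of two sequences indexed by `ℤ`. -/
def conv (a b : ℤ → M) (m : ℤ) : M := ∑' k, a k * b (m - k)

/-- The bijection `(m, k) ↦ (k, m - k)` of `ℤ × ℤ`. -/
def convEquiv : ℤ × ℤ ≃ ℤ × ℤ where
  toFun p := (p.2, p.1 - p.2)
  invFun q := (q.1 + q.2, q.1)
  left_inv p := by simp
  right_inv q := by simp

theorem summable_norm_convEquiv {a b : ℤ → M} (ha : Summable fun m => ‖a m‖)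
    (hb : Summable fun m => ‖b m‖) :
    Summable fun p : ℤ × ℤ => ‖a p.2 * b (p.1 - p.2)‖ :=
  (convEquiv.summable_iff (f := fun q : ℤ × ℤ => ‖a q.1 * b q.2‖)).2 (ha.mul_norm hb)

theorem summable_norm_conv {a b : ℤ → M} (ha : Summable fun m => ‖a m‖)
    (hb : Summable fun m => ‖b m‖) : Summable fun m => ‖conv a b m‖ := by
  have h := summable_norm_convEquiv ha hb
  exact h.prod.of_nonneg_of_le (fun _ => norm_nonneg _)
    fun m => norm_tsum_le_tsum_norm (h.prod_factor m)

variable [NormedAlgebra ℂ M] [CompleteSpace M] [NormedRing B] [NormedAlgebra ℂ B] [CompleteSpace B]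

/-- A graded multiplicative family turns convolution into multiplication. -/
theorem tsum_mul_tsum_eq_tsum_conv (ρ : ℤ → M →L[ℂ] B)
    (hρ : ∀ k l x y, ρ k x * ρ l y = ρ (k + l) (x * y)) (hn : ∀ k x, ‖ρ k x‖ ≤ ‖x‖)
    {a b : ℤ → M} (ha : Summable fun m => ‖a m‖) (hb : Summable fun m => ‖b m‖) :
    (∑' k, ρ k (a k)) * ∑' k, ρ k (b k) = ∑' m, ρ m (conv a b m) := by
  have ha' : Summable fun k => ‖ρ k (a k)‖ :=
    ha.of_nonneg_of_le (fun _ => norm_nonneg _) fun k => hn k _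
  have hb' : Summable fun k => ‖ρ k (b k)‖ :=
    hb.of_nonneg_of_le (fun _ => norm_nonneg _) fun k => hn k _
  have h := summable_norm_convEquiv ha hb
  rw [tsum_mul_tsum_of_summable_norm ha' hb', ← convEquiv.tsum_eq]
  have hs : Summable fun p : ℤ × ℤ => ρ p.1 (a p.2 * b (p.1 - p.2)) :=
    .of_norm (h.of_nonneg_of_le (fun _ => norm_nonneg _) fun p => hn _ _)
  have he (p : ℤ × ℤ) : ρ (convEquiv p).1 (a (convEquiv p).1) *
      ρ (convEquiv p).2 (b (convEquiv p).2) = ρ p.1 (a p.2 * b (p.1 - p.2)) := by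
    rw [hρ]; simp [convEquiv]
  simp only [he]
  rw [hs.tsum_prod]
  exact tsum_congr fun m => ((ρ m).map_tsum (h.prod_factor m).of_norm).symm

end Convolution

/-! ### Products and inverses of smooth loops -/

section Loops

variable {M : Type*} [NormedRing M] [NormedAlgebra ℂ M] {f g : ℝ → M}

/-- The term `x ↦ e ^ (- i m t) x` of the Fourier series. -/
def characterSMul (t : ℝ) (m : ℤ) : M →L[ℂ] M := character (-m) t • ContinuousLinearMap.id ℂ M

theorem characterSMul_apply (t : ℝ) (m : ℤ) (x : M) :
    characterSMul t m x = character (-m) t • x := rfl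

theorem IsSmoothLoop.mul (hf : IsSmoothLoop f) (hg : IsSmoothLoop g) :
    IsSmoothLoop fun t => f t * g t where
  contDiff := hf.contDiff.mul hg.contDiff
  periodic t := by simp [hf.periodic t, hg.periodic t]

/-- Multiply the two Fourier series pointwise and use uniqueness of the coefficients,
`loopCoeff_tsum`. -/
theorem IsSmoothLoop.loopCoeff_mul [CompleteSpace M] (hf : IsSmoothLoop f) (hg : IsSmoothLoop g) :
    loopCoeff (fun t => f t * g t) = conv (loopCoeff f) (loopCoeff g) := by
  have h (t : ℝ) : f t * g t =
      ∑' m, character (-m) t • conv (loopCoeff f) (loopCoeff g) m := by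
    have h1 := tsum_mul_tsum_eq_tsum_conv (characterSMul (M := M) t)
      (fun k l x y => by
        simp only [characterSMul_apply, smul_mul_smul_comm, ← character_add]
        congr 2; ring)
      (fun k x => by rw [characterSMul_apply, norm_smul, norm_character, one_mul])
      hf.summable_norm_loopCoeff hg.summable_norm_loopCoeff
    simp only [characterSMul_apply] at h1
    rw [← h1, (hf.hasSum t).tsum_eq, (hg.hasSum t).tsum_eq]
  rw [funext h]
  exact funext (loopCoeff_tsum
    (summable_norm_conv hf.summable_norm_loopCoeff hg.summable_norm_loopCoeff))

theorem loopCoeff_const [CompleteSpace M] (x : M) (m : ℤ) :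
    loopCoeff (fun _ : ℝ => x) m = if m = 0 then x else 0 := by
  have hpi : (2 * Real.pi : ℂ) ≠ 0 := by exact_mod_cast Real.two_pi_pos.ne'
  rw [loopCoeff, intervalIntegral.integral_smul_const, integral_character]
  split_ifs
  · push_cast
    rw [smul_smul, inv_mul_cancel₀ hpi, one_smul]
  · simp

theorem IsSmoothLoop.inverse [CompleteSpace M] (hf : IsSmoothLoop f) (hu : ∀ t, IsUnit (f t)) :
    IsSmoothLoop fun t => Ring.inverse (f t) where
  contDiff := contDiff_iff_contDiffAt.2 fun t => by
    obtain ⟨u, hu⟩ := hu t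
    have h : ContDiffAt ℝ ∞ Ring.inverse (f t) := hu ▸ contDiffAt_ringInverse ℝ u
    exact h.comp t hf.contDiff.contDiffAt
  periodic t := by simp [hf.periodic t]

end Loops

/-! ### Adjoints and square roots of smooth loops -/

section CStar

variable {M : Type*} [CStarAlgebra M] {f : ℝ → M}

theorem IsSmoothLoop.star (hf : IsSmoothLoop f) : IsSmoothLoop fun t => star (f t) where
  contDiff := (starL' ℝ : M ≃L[ℝ] M).contDiff.comp hf.contDiff
  periodic t := by simp [hf.periodic t]

theorem IsSmoothLoop.loopCoeff_star (hf : IsSmoothLoop f) (m : ℤ) :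
    loopCoeff (fun t => Star.star (f t)) m = Star.star (loopCoeff f (-m)) := by
  have hc : Continuous fun t => character (-m) t • f t :=
    (continuous_character _).smul hf.continuous
  have h := (starL' ℝ : M ≃L[ℝ] M).toContinuousLinearMap.intervalIntegral_comp_comm
    (hc.intervalIntegrable (μ := MeasureTheory.volume) 0 (2 * Real.pi))
  simp only [ContinuousLinearEquiv.coe_coe, starL'_apply, star_smul, star_character,
    neg_neg] at h
  rw [loopCoeff, loopCoeff, star_smul, h]
  simp

variable [PartialOrder M] [StarOrderedRing M]

/-- Anticommuting with `x` implies commuting with `x * x`, hence with its positive square root `x`;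
then `2 x y = 0`. This makes the derivative of squaring injective at `x`. -/
theorem eq_zero_of_mul_add_mul_eq_zero {x y : M} (hx : 0 ≤ x) (hu : IsUnit x)
    (h : x * y + y * x = 0) : y = 0 := by
  have h1 : x * y = -(y * x) := eq_neg_of_add_eq_zero_left h
  have h2 : Commute y (x * x) := by
    change y * (x * x) = x * x * y
    rw [mul_assoc x x y, h1, mul_neg, ← mul_assoc x y x, h1]
    simp [mul_assoc]
  have h3 : Commute y x := by
    rw [← CFC.sqrt_mul_self x hx]
    exact (Commute.cfcₙ_nnreal (Commute.symm h2) NNReal.sqrt).symm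
  rw [h3.eq, ← two_smul ℂ] at h
  have h4 : x * y = 0 := by
    refine (smul_eq_zero.1 h).resolve_left two_ne_zero
  exact hu.mul_right_eq_zero.1 h4

/-- Inverse function theorem for `y ↦ y * y` at `a = √(x t)`. The derivative `y ↦ a y + y a` is
injective, hence invertible in finite dimension. -/
theorem contDiffAt_sqrt_comp [FiniteDimensional ℝ M] {n : WithTop ℕ∞} (hn : n ≠ 0) {x : ℝ → M}
    {t : ℝ} (hx : ContDiffAt ℝ n x t) (h0 : ∀ t, 0 ≤ x t) (hu : IsUnit (x t)) :
    ContDiffAt ℝ n (fun t => CFC.sqrt (x t)) t := by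
  set a := CFC.sqrt (x t)
  have ha0 : 0 ≤ a := CFC.sqrt_nonneg _
  have haa : a * a = x t := CFC.sqrt_mul_sqrt_self (x t) (h0 t)
  have hau : IsUnit a := by
    rw [← haa] at hu
    exact ((Commute.refl a).isUnit_mul_iff.1 hu).1
  have hsq : ContDiffAt ℝ n (fun y : M => y * y) a := contDiffAt_id.mul contDiffAt_id
  let D : M →ₗ[ℝ] M := LinearMap.mulLeft ℝ a + LinearMap.mulRight ℝ a
  have hD : Function.Injective D := by
    refine (injective_iff_map_eq_zero D).2 fun y hy => ?_
    exact eq_zero_of_mul_add_mul_eq_zero ha0 hau hy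
  let D' : M ≃L[ℝ] M := (LinearEquiv.ofInjectiveEndo D hD).toContinuousLinearEquiv
  have hder : HasFDerivAt (fun y : M => y * y) (D' : M →L[ℝ] M) a := by
    refine ((hasFDerivAt_id a).mul' (hasFDerivAt_id a)).congr_fderiv ?_
    ext y
    simp [D', D]
  have hinv : ContDiffAt ℝ n (hsq.localInverse hder hn) (x t) := by
    rw [← haa]
    exact hsq.to_localInverse hder hn
  refine (hinv.comp t hx).congr_of_eventuallyEq ?_
  -- Continuity keeps nearby positive roots close to `a`, where the local inverse undoes squaring;
  -- so it agrees with the positive root.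
  have hcont : ContinuousAt (fun t => CFC.sqrt (x t)) t := by
    exact (CFC.continuousOn_sqrt (x t) (h0 t)).tendsto.comp
      (tendsto_nhdsWithin_iff.2 ⟨hx.continuousAt, .of_forall h0⟩)
  have hleft := (hsq.hasStrictFDerivAt' hder hn).eventually_left_inverse
  filter_upwards [hcont.eventually hleft] with s hs
  rw [CFC.sqrt_mul_sqrt_self (x s) (h0 s)] at hs
  exact hs.symm

theorem IsSmoothLoop.sqrt [FiniteDimensional ℝ M] (hf : IsSmoothLoop f) (h0 : ∀ t, 0 ≤ f t)
    (hu : ∀ t, IsUnit (f t)) : IsSmoothLoop fun t => CFC.sqrt (f t) where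
  contDiff := contDiff_iff_contDiffAt.2 fun t =>
    contDiffAt_sqrt_comp (by simp) hf.contDiff.contDiffAt h0 (hu t)
  periodic t := by simp [hf.periodic t]

end CStar

/-! ### Laurent operators on the chain -/

section Laurent

variable {N : ℕ}

/-- Operators of the fibre `ℂ^N`. -/
abbrev FiberOp (N : ℕ) : Type := EuclideanSpace ℂ (Fin N) →L[ℂ] EuclideanSpace ℂ (Fin N)

instance : CompleteSpace (FiberOp N) := inferInstance

instance : T2Space (FiberOp N) := inferInstance

instance : FiniteDimensional ℝ (FiberOp N) := inferInstance

theorem translate_memℓp (m : ℤ) (ψ : Chain N) : Memℓp (fun n : ℤ => ψ (n - m)) 2 := by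
  have h := (lp.memℓp ψ).summable (by norm_num)
  exact memℓp_gen
    ((Equiv.subRight m).summable_iff (f := fun n : ℤ => ‖ψ n‖ ^ (2 : ENNReal).toReal) |>.mpr h)

/-- The translation `(τ ψ) n = ψ (n - m)`. -/
def translate (N : ℕ) (m : ℤ) : Chain N →L[ℂ] Chain N :=
  LinearMap.mkContinuous
    { toFun := fun ψ => (⟨fun n : ℤ => ψ (n - m), translate_memℓp m ψ⟩ : Chain N)
      map_add' := fun _ _ => rfl
      map_smul' := fun _ _ => rfl }
    1 (fun ψ => by
      rw [one_mul, lp.norm_eq_tsum_rpow (by norm_num), lp.norm_eq_tsum_rpow (by norm_num)]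
      refine le_of_eq (congrArg (· ^ _) ?_)
      exact (Equiv.subRight m).tsum_eq (fun n : ℤ => ‖ψ n‖ ^ (2 : ENNReal).toReal))

theorem norm_translate_le (m : ℤ) : ‖translate N m‖ ≤ 1 :=
  LinearMap.mkContinuous_norm_le _ zero_le_one _

/-- The operator `(hop m A ψ) n = A (ψ (n - m))`. -/
def hop (m : ℤ) : FiberOp N →L[ℂ] Chain N →L[ℂ] Chain N :=
  LinearMap.mkContinuous
    { toFun := fun A => lp.mapCLM 2 (fun _ => A) (norm_nonneg A) (fun _ => le_rfl) ∘L translate N m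
      map_add' := fun _ _ => rfl
      map_smul' := fun _ _ => rfl }
    1 (fun A => by
      refine (opNorm_comp_le _ _).trans ?_
      rw [mul_comm]
      exact mul_le_mul (norm_translate_le m) (lp.norm_mapCLM_le _ _ _ _) (norm_nonneg _)
        zero_le_one)

theorem hop_apply (m : ℤ) (A : FiberOp N) (ψ : Chain N) (n : ℤ) :
    hop m A ψ n = A (ψ (n - m)) := rfl

theorem norm_hop_le (m : ℤ) (A : FiberOp N) : ‖hop m A‖ ≤ ‖A‖ := by
  have h : ‖hop (N := N) m‖ ≤ 1 := LinearMap.mkContinuous_norm_le _ zero_le_one _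
  simpa using (hop m).le_of_opNorm_le h A

theorem hop_mul_hop (k l : ℤ) (A B : FiberOp N) : hop k A * hop l B = hop (k + l) (A * B) := by
  ext ψ n : 3
  change A (B (ψ (n - k - l))) = A (B (ψ (n - (k + l))))
  rw [sub_sub]

theorem hop_zero_one : hop 0 (1 : FiberOp N) = 1 := by
  ext ψ n : 3
  change ψ (n - 0) = ψ n
  rw [sub_zero]

theorem star_hop (m : ℤ) (A : FiberOp N) : star (hop m A) = hop (-m) (star A) := by
  refine ((eq_adjoint_iff _ _).2 fun ψ φ => ?_).symm
  rw [lp.inner_eq_tsum, lp.inner_eq_tsum]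
  refine Eq.trans ?_ ((Equiv.addRight m).tsum_eq fun n => inner ℂ (ψ n) (hop m A φ n))
  refine tsum_congr fun n => ?_
  simp only [hop_apply, Equiv.coe_addRight, add_sub_cancel_right, sub_neg_eq_add]
  rw [star_eq_adjoint, adjoint_inner_left]

/-- The block Toeplitz operator with coefficients `a`: `(L_a ψ) n = ∑ m, a_m (ψ (n - m))`. -/
def laurentOp (a : ℤ → FiberOp N) : Chain N →L[ℂ] Chain N := ∑' m, hop m (a m)

section Summable

variable {a b : ℤ → FiberOp N}

theorem summable_norm_hop (ha : Summable fun m => ‖a m‖) : Summable fun m => ‖hop m (a m)‖ :=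
  ha.of_nonneg_of_le (fun _ => norm_nonneg _) fun m => norm_hop_le m (a m)

theorem hasSum_laurentOp (ha : Summable fun m => ‖a m‖) :
    HasSum (fun m => hop m (a m)) (laurentOp a) :=
  (summable_norm_hop ha).of_norm.hasSum

theorem hasSum_laurentOp_apply (ha : Summable fun m => ‖a m‖) (ψ : Chain N) :
    HasSum (fun m => hop m (a m) ψ) (laurentOp a ψ) :=
  (hasSum_laurentOp ha).mapL (ContinuousLinearMap.apply ℂ (Chain N) ψ)

theorem laurentOp_single (ha : Summable fun m => ‖a m‖) (k n : ℤ)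
    (v : EuclideanSpace ℂ (Fin N)) :
    laurentOp a (lp.single 2 k v) n = a (n - k) v := by
  have h := (hasSum_laurentOp_apply ha (lp.single 2 k v)).mapL
    (lp.evalCLM ℂ (fun _ : ℤ => EuclideanSpace ℂ (Fin N)) 2 n)
  have h2 : HasSum (fun m => lp.evalCLM ℂ (fun _ : ℤ => EuclideanSpace ℂ (Fin N)) 2 n
      (hop m (a m) (lp.single 2 k v))) (a (n - k) v) := by
    convert hasSum_single (n - k) fun m hm => ?_ using 1
    · change a (n - k) v = a (n - k) ((lp.single 2 k v : Chain N) (n - (n - k)))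
      rw [sub_sub_cancel, lp.single_apply_self]
    · change a m ((lp.single 2 k v : Chain N) (n - m)) = 0
      rw [lp.single_apply_ne, map_zero]
      omega
  exact h.unique h2

theorem laurentOp_mul (ha : Summable fun m => ‖a m‖) (hb : Summable fun m => ‖b m‖) :
    laurentOp a * laurentOp b = laurentOp (conv a b) :=
  tsum_mul_tsum_eq_tsum_conv hop hop_mul_hop norm_hop_le ha hb

end Summable

theorem clm_ext_single {A B : Chain N →L[ℂ] Chain N}
    (h : ∀ (k n : ℤ) (v : EuclideanSpace ℂ (Fin N)),
      A (lp.single 2 k v) n = B (lp.single 2 k v) n) : A = B := by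
  refine lp.ext_continuousLinearMap (by norm_num) fun k => ?_
  ext v : 1
  exact lp.ext (funext fun n => h k n v)

theorem commute_hop_one {S : Chain N →L[ℂ] Chain N} (hS : Commute S (shift N)) (m : ℤ) :
    Commute S (hop m 1) := by
  have h1 : Commute S (hop 1 1) := hS
  have hinv : Commute S (hop (-1) 1) := by
    have e1 : hop (-1) 1 * hop 1 1 = (1 : Chain N →L[ℂ] Chain N) := by
      rw [hop_mul_hop]; simp [hop_zero_one]
    have e2 : hop 1 1 * hop (-1) 1 = (1 : Chain N →L[ℂ] Chain N) := by
      rw [hop_mul_hop]; simp [hop_zero_one]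
    calc S * hop (-1) 1 = hop (-1) 1 * (hop 1 1 * S) * hop (-1) 1 := by
          rw [← mul_assoc, e1, one_mul]
      _ = hop (-1) 1 * S * (hop 1 1 * hop (-1) 1) := by rw [← h1.eq]; simp only [mul_assoc]
      _ = hop (-1) 1 * S := by rw [e2, mul_one]
  induction m using Int.induction_on with
  | zero => rw [hop_zero_one]; exact Commute.one_right S
  | succ m ih =>
    have := ih.mul_right h1
    rwa [hop_mul_hop, one_mul] at this
  | pred m ih =>
    have := ih.mul_right hinv
    rwa [hop_mul_hop, one_mul] at this

/-- An operator that commutes with the shift is the Laurent operator of its coefficients. -/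
theorem laurentOp_coeff {S : Chain N →L[ℂ] Chain N} (hS : Commute S (shift N))
    (ha : Summable fun m => ‖coeff S m‖) : laurentOp (coeff S) = S := by
  refine clm_ext_single fun k n v => ?_
  rw [laurentOp_single ha]
  have h1 : (lp.single 2 k v : Chain N) = hop k 1 (lp.single 2 0 v) := by
    refine lp.ext (funext fun j => ?_)
    change (lp.single 2 k v : Chain N) j = (lp.single 2 0 v : Chain N) (j - k)
    by_cases hj : j = k
    · subst hj; rw [sub_self, lp.single_apply_self, lp.single_apply_self]
    · rw [lp.single_apply_ne _ _ _ hj, lp.single_apply_ne _ _ _ (sub_ne_zero.2 hj)]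
  have h2 : S (hop k 1 (lp.single 2 0 v)) = hop k 1 (S (lp.single 2 0 v)) :=
    congrArg (fun A => A (lp.single 2 0 v)) (commute_hop_one hS k).eq
  rw [h1, h2]
  rfl

/-- The operator with symbol `f`. -/
def symbolOp (f : ℝ → FiberOp N) : Chain N →L[ℂ] Chain N := laurentOp (loopCoeff f)

/-- Both products convolve the coefficients. Together with `symbolOp_one` and `star_symbolOp`, this
transfers pointwise identities between loops to operators. -/
theorem symbolOp_mul {f g : ℝ → FiberOp N} (hf : IsSmoothLoop f) (hg : IsSmoothLoop g) :
    symbolOp f * symbolOp g = symbolOp fun t => f t * g t := by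
  rw [symbolOp, symbolOp, symbolOp, hf.loopCoeff_mul hg,
    laurentOp_mul hf.summable_norm_loopCoeff hg.summable_norm_loopCoeff]

theorem symbolOp_one : symbolOp (fun _ => (1 : FiberOp N)) = 1 := by
  rw [symbolOp, laurentOp, tsum_eq_single 0, loopCoeff_const, if_pos rfl, hop_zero_one]
  intro m hm
  rw [loopCoeff_const, if_neg hm, map_zero]

theorem star_symbolOp {f : ℝ → FiberOp N} (hf : IsSmoothLoop f) :
    star (symbolOp f) = symbolOp fun t => star (f t) := by
  have h := (hasSum_laurentOp hf.summable_norm_loopCoeff).star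
  simp only [star_hop] at h
  have h2 := hasSum_laurentOp hf.star.summable_norm_loopCoeff
  rw [← (Equiv.neg ℤ).hasSum_iff] at h2
  have h3 : (fun m => hop m (loopCoeff (fun t => star (f t)) m)) ∘ Equiv.neg ℤ =
      fun m => hop (-m) (star (loopCoeff f m)) := by
    funext m
    simp [hf.loopCoeff_star]
  rw [h3] at h2
  exact h.unique h2

end Laurent

section Gap

variable {N : ℕ}

/-! ### Approximate eigenvectors -/

/-- The plane wave `n ↦ e ^ (i n t) v` cut off to `0 ≤ n < L`. -/
def planeWave (t : ℝ) (v : EuclideanSpace ℂ (Fin N)) (L : ℕ) : Chain N :=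
  ∑ n ∈ (Finset.range L).image (fun n : ℕ => (n : ℤ)), lp.single 2 n (character n t • v)

theorem planeWave_apply (t : ℝ) (v : EuclideanSpace ℂ (Fin N)) (L : ℕ) (n : ℤ) :
    planeWave t v L n = if 0 ≤ n ∧ n < L then character n t • v else 0 := by
  rw [planeWave, lp.coeFn_sum, Finset.sum_apply]
  simp only [lp.coeFn_single]
  rw [Finset.sum_pi_single]
  congr 1
  simp only [Finset.mem_image, Finset.mem_range, eq_iff_iff]
  constructor
  · rintro ⟨k, hk, rfl⟩; omega
  · rintro ⟨h1, h2⟩; exact ⟨n.toNat, by omega, by omega⟩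

theorem norm_planeWave_sq (t : ℝ) (v : EuclideanSpace ℂ (Fin N)) (L : ℕ) :
    ‖planeWave t v L‖ ^ 2 = L * ‖v‖ ^ 2 := by
  have h := lp.norm_sum_single (p := 2) (E := fun _ : ℤ => EuclideanSpace ℂ (Fin N)) (by norm_num)
    (fun n => character n t • v) ((Finset.range L).image (fun n : ℕ => (n : ℤ)))
  simp only [norm_smul, norm_character, one_mul, ENNReal.toReal_ofNat, Real.rpow_ofNat,
    Finset.sum_const, nsmul_eq_mul] at h
  rwa [Finset.card_image_of_injective _ Nat.cast_injective, Finset.card_range] at h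

/-- The eigenvalue equation fails only at the two cut-off sites `0` and `L`, so the defect is
bounded independently of `L`. -/
theorem norm_shift_planeWave_sub_le (t : ℝ) (v : EuclideanSpace ℂ (Fin N)) (L : ℕ) :
    ‖hop 1 1 (planeWave t v L) - character (-1) t • planeWave t v L‖ ≤ 2 * ‖v‖ := by
  have h : hop 1 1 (planeWave t v L) - character (-1) t • planeWave t v L =
      lp.single 2 (L : ℤ) (character (L - 1) t • v) -
        (lp.single 2 0 (character (-1) t • v) : Chain N) := by
    refine lp.ext (funext fun n => ?_)
    change planeWave t v L (n - 1) - character (-1) t • planeWave t v L n =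
      (lp.single 2 (L : ℤ) (character (L - 1) t • v) : Chain N) n -
        (lp.single 2 0 (character (-1) t • v) : Chain N) n
    rw [planeWave_apply, planeWave_apply, lp.coeFn_single, lp.coeFn_single, Pi.single_apply,
      Pi.single_apply]
    have e (n : ℤ) : character (n - 1) t • v = character (-1) t • character n t • v := by
      rw [smul_smul, ← character_add, neg_add_eq_sub]
    simp only [e]
    clear e
    split_ifs with h1 h2 h3 h4 h5 h6 <;>
      first
      | (exfalso; omega)
      | simp_all [character_zero]
  rw [h]
  refine (norm_sub_le _ _).trans ?_
  rw [lp.norm_single (by norm_num), lp.norm_single (by norm_num), norm_smul, norm_smul,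
    norm_character, norm_character]
  linarith

/-- Telescoping: translations are contractions and characters have modulus one, so each step adds at
most `c`. Negative `m` reduces to positive `m` by translating back. -/
theorem norm_hop_one_sub_le {ψ : Chain N} {t c : ℝ}
    (h : ‖hop 1 1 ψ - character (-1) t • ψ‖ ≤ c) (m : ℤ) :
    ‖hop m 1 ψ - character (-m) t • ψ‖ ≤ |(m : ℝ)| * c := by
  have hop_le (k : ℤ) (φ : Chain N) : ‖hop k 1 φ‖ ≤ ‖φ‖ := by
    refine ((hop k 1).le_opNorm φ).trans (mul_le_of_le_one_left (norm_nonneg _) ?_)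
    exact (norm_hop_le k 1).trans ContinuousLinearMap.norm_id_le
  have hadd (k l : ℤ) : hop (k + l) 1 ψ = hop k 1 (hop l 1 ψ) := by
    have := congrArg (fun A => A ψ) (hop_mul_hop k l (1 : FiberOp N) 1)
    rw [one_mul] at this
    exact this.symm
  have hnat (m : ℕ) : ‖hop (m : ℤ) 1 ψ - character (-m) t • ψ‖ ≤ m * c := by
    induction m with
    | zero => simp [hop_zero_one, character_zero]
    | succ m ih =>
      have e : hop ((m + 1 : ℕ) : ℤ) 1 ψ - character (-((m + 1 : ℕ) : ℤ)) t • ψ =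
          hop m 1 (hop 1 1 ψ - character (-1) t • ψ) +
            character (-1) t • (hop m 1 ψ - character (-m) t • ψ) := by
        rw [map_sub, map_smul, ← hadd, smul_sub, smul_smul, ← character_add]
        push_cast
        rw [neg_add_rev]
        abel
      rw [e]
      refine (norm_add_le _ _).trans ?_
      rw [norm_smul, norm_character, one_mul]
      have := (hop_le m _).trans h
      push_cast
      linarith
  obtain ⟨k, rfl | rfl⟩ := m.eq_nat_or_neg
  · simpa using hnat k
  · have e : hop (-(k : ℤ)) 1 ψ - character (- -(k : ℤ)) t • ψ =
        - character k t • hop (-(k : ℤ)) 1 (hop k 1 ψ - character (-k) t • ψ) := by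
      rw [map_sub, map_smul, ← hadd, neg_add_cancel, neg_smul, smul_sub, smul_smul,
        ← character_add, add_neg_cancel, character_zero, hop_zero_one, neg_neg]
      simp
    rw [e, norm_smul, norm_neg, norm_character, one_mul]
    refine (hop_le _ _).trans ((hnat k).trans_eq ?_)
    simp

/-- If a Laurent operator is invertible, then so is its symbol. -/
theorem eq_zero_of_isUnit_laurentOp {a : ℤ → FiberOp N} (ha : Summable fun m => ‖a m‖)
    (ha' : Summable fun m : ℤ => |(m : ℝ)| * ‖a m‖) (hu : IsUnit (laurentOp a)) {t : ℝ}
    {v : EuclideanSpace ℂ (Fin N)} (hv : (∑' m, character (-m) t • a m) v = 0) : v = 0 := by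
  have hs : Summable fun m => character (-m) t • a m :=
    .of_norm (by simpa [norm_smul, norm_character] using ha)
  set C := ∑' m : ℤ, |(m : ℝ)| * ‖a m‖
  have hbound (L : ℕ) : ‖laurentOp a (planeWave t v L)‖ ≤ C * (2 * ‖v‖) := by
    set ψ := planeWave t v L
    have h1 := hasSum_laurentOp_apply ha ψ
    -- The symbol at `t`, applied site by site, kills the plane wave. Subtracting this zero series
    -- term by term leaves only translation defects, of size `|m| ‖a m‖`.
    have h2 : HasSum (fun m => hop 0 (character (-m) t • a m) ψ) 0 := by
      have h3 := (hs.hasSum.mapL (hop 0)).mapL (ContinuousLinearMap.apply ℂ (Chain N) ψ)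
      have h4 : ContinuousLinearMap.apply ℂ (Chain N) ψ
          (hop 0 (∑' m, character (-m) t • a m)) = 0 := by
        refine lp.ext (funext fun n => ?_)
        change (∑' m, character (-m) t • a m) (planeWave t v L (n - 0)) = 0
        rw [planeWave_apply]
        split_ifs
        · rw [map_smul, hv, smul_zero]
        · rw [map_zero]
      rw [h4] at h3
      exact h3
    have h4 := h1.sub h2
    rw [sub_zero] at h4
    have h5 (m : ℤ) : ‖hop m (a m) ψ - hop 0 (character (-m) t • a m) ψ‖ ≤
        |(m : ℝ)| * ‖a m‖ * (2 * ‖v‖) := by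
      have e : hop m (a m) ψ - hop 0 (character (-m) t • a m) ψ =
          hop 0 (a m) (hop m 1 ψ - character (-m) t • ψ) := by
        have : hop 0 (a m) * hop m 1 = hop m (a m) := by rw [hop_mul_hop, zero_add, mul_one]
        rw [map_sub, map_smul, map_smul, ← this]
        rfl
      rw [e]
      refine ((hop 0 (a m)).le_opNorm _).trans ?_
      refine (mul_le_mul (norm_hop_le 0 (a m))
        (norm_hop_one_sub_le (norm_shift_planeWave_sub_le t v L) m) (norm_nonneg _)
        (norm_nonneg _)).trans_eq ?_
      ring
    have h6 := (ha'.mul_right (2 * ‖v‖)).hasSum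
    rw [tsum_mul_right] at h6
    exact h4.norm_le_of_bounded h6 h5
  obtain ⟨u, hu⟩ := hu
  by_contra hv0
  have hvpos : 0 < ‖v‖ := norm_pos_iff.2 hv0
  set D := ‖(↑u⁻¹ : Chain N →L[ℂ] Chain N)‖
  -- The inverse would give `L ‖v‖² = ‖ψ‖² ≤ (2 C D)² ‖v‖²`, which fails for this `L`.
  obtain ⟨L, hL⟩ := exists_nat_gt ((D * (C * 2)) ^ 2)
  have h1 : ‖planeWave t v L‖ ≤ D * (C * (2 * ‖v‖)) := by
    have e : planeWave t v L = (↑u⁻¹ : Chain N →L[ℂ] Chain N) (laurentOp a (planeWave t v L)) := by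
      rw [← hu]
      exact (congrArg (fun A : Chain N →L[ℂ] Chain N => A (planeWave t v L)) u.inv_mul).symm
    calc ‖planeWave t v L‖ = _ := congrArg norm e
      _ ≤ D * ‖laurentOp a (planeWave t v L)‖ := le_opNorm _ _
      _ ≤ _ := by gcongr; exact hbound L
  have h2 : ‖planeWave t v L‖ ^ 2 ≤ (D * (C * (2 * ‖v‖))) ^ 2 := by gcongr
  rw [norm_planeWave_sq] at h2
  have h3 : (D * (C * (2 * ‖v‖))) ^ 2 = (D * (C * 2)) ^ 2 * ‖v‖ ^ 2 := by ring
  rw [h3] at h2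
  have h4 := le_of_mul_le_mul_right h2 (by positivity)
  linarith

theorem isUnit_of_ker_eq_bot {A : FiberOp N} (h : ∀ v, A v = 0 → v = 0) : IsUnit A := by
  rw [isUnit_iff_bijective]
  have hi : Function.Injective (A : EuclideanSpace ℂ (Fin N) →ₗ[ℂ] EuclideanSpace ℂ (Fin N)) :=
    (injective_iff_map_eq_zero _).2 h
  exact ⟨hi, LinearMap.injective_iff_surjective.1 hi⟩

theorem isUnit_iff_det_ne_zero {A : FiberOp N} : IsUnit A ↔ A.det ≠ 0 := by
  rw [← isUnit_iff_ne_zero, ContinuousLinearMap.det, ← LinearMap.isUnit_iff_isUnit_det,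
    isUnit_iff_bijective, Module.End.isUnit_iff]
  rfl

theorem isUnit_symbolOp_iff {f : ℝ → FiberOp N} (hf : IsSmoothLoop f) :
    IsUnit (symbolOp f) ↔ ∀ t, IsUnit (f t) := by
  constructor
  · intro h t
    refine isUnit_of_ker_eq_bot fun v hv => ?_
    refine eq_zero_of_isUnit_laurentOp hf.summable_norm_loopCoeff
      hf.summable_abs_mul_norm_loopCoeff h (t := t) ?_
    rw [(hf.hasSum t).tsum_eq, hv]
  · intro h
    refine isUnit_iff_exists.2 ⟨symbolOp fun t => Ring.inverse (f t), ?_, ?_⟩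
    · rw [symbolOp_mul hf (hf.inverse h), ← symbolOp_one]
      simp only [Ring.mul_inverse_cancel _ (h _)]
    · rw [symbolOp_mul (hf.inverse h) hf, ← symbolOp_one]
      simp only [Ring.inverse_mul_cancel _ (h _)]

/-! ### The polar decomposition -/

section Polar

variable {s : ℝ → FiberOp N}

theorem isUnit_abs_of_isUnit {A : FiberOp N} (hA : IsUnit A) : IsUnit (CFC.abs A) := by
  have h : IsUnit (CFC.abs A * CFC.abs A) := by
    rw [CFC.abs_mul_abs]; exact hA.star.mul hA
  exact ((Commute.refl _).isUnit_mul_iff.1 h).1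

theorem IsSmoothLoop.abs (hs : IsSmoothLoop s) (hu : ∀ t, IsUnit (s t)) :
    IsSmoothLoop fun t => CFC.abs (s t) :=
  (hs.star.mul hs).sqrt (fun t => star_mul_self_nonneg (s t)) fun t => (hu t).star.mul (hu t)

/-- The unitary factor in the polar decomposition of `A`, if `A` is invertible. -/
def polarFactor (A : FiberOp N) : FiberOp N := A * Ring.inverse (CFC.abs A)

theorem IsSmoothLoop.polarFactor (hs : IsSmoothLoop s) (hu : ∀ t, IsUnit (s t)) :
    IsSmoothLoop fun t => polarFactor (s t) :=
  hs.mul ((hs.abs hu).inverse fun t => isUnit_abs_of_isUnit (hu t))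

theorem polarFactor_mul_abs {A : FiberOp N} (hA : IsUnit A) :
    ChiralChain.polarFactor A * CFC.abs A = A := by
  rw [ChiralChain.polarFactor, mul_assoc, Ring.inverse_mul_cancel _ (isUnit_abs_of_isUnit hA),
    mul_one]

theorem isUnit_polarFactor {A : FiberOp N} (hA : IsUnit A) :
    IsUnit (ChiralChain.polarFactor A) :=
  hA.mul (isUnit_abs_of_isUnit hA).ringInverse

theorem star_polarFactor_mul_self {A : FiberOp N} (hA : IsUnit A) :
    star (ChiralChain.polarFactor A) * ChiralChain.polarFactor A = 1 := by
  have h := isUnit_abs_of_isUnit hA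
  have hsa : star (CFC.abs A) = CFC.abs A := (IsSelfAdjoint.of_nonneg (CFC.abs_nonneg A)).star_eq
  have h1 : star (Ring.inverse (CFC.abs A)) = Ring.inverse (CFC.abs A) := by
    rw [← Ring.inverse_star, hsa]
  rw [ChiralChain.polarFactor, star_mul, h1, mul_assoc, ← mul_assoc (star A) A,
    ← CFC.abs_mul_abs A, mul_assoc, Ring.mul_inverse_cancel _ h, mul_one,
    Ring.inverse_mul_cancel _ h]

theorem polarFactor_mul_star_self {A : FiberOp N} (hA : IsUnit A) :
    ChiralChain.polarFactor A * star (ChiralChain.polarFactor A) = 1 := by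
  refine (isUnit_polarFactor hA).mul_right_cancel ?_
  rw [mul_assoc, star_polarFactor_mul_self hA, one_mul, mul_one]

/-- The polar decomposition of an operator with smooth invertible symbol is computed pointwise. -/
theorem isPolarUnitary_symbolOp (hs : IsSmoothLoop s) (hu : ∀ t, IsUnit (s t)) :
    IsPolarUnitary (symbolOp s) (symbolOp fun t => ChiralChain.polarFactor (s t)) := by
  have hp := hs.abs hu
  have hv := hs.polarFactor hu
  -- A second smooth root exhibits the operator with symbol `|s|` in the form `q† q`, which shows
  -- that it is positive.
  have hq := hp.sqrt (fun t => CFC.abs_nonneg (s t)) fun t => isUnit_abs_of_isUnit (hu t)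
  have hqq : star (symbolOp fun t => CFC.sqrt (CFC.abs (s t))) *
      symbolOp (fun t => CFC.sqrt (CFC.abs (s t))) = symbolOp fun t => CFC.abs (s t) := by
    rw [star_symbolOp hq, symbolOp_mul hq.star hq]
    congr 1
    funext t
    rw [(IsSelfAdjoint.of_nonneg (CFC.sqrt_nonneg (CFC.abs (s t)))).star_eq,
      CFC.sqrt_mul_sqrt_self _ (CFC.abs_nonneg (s t))]
  refine isPolarUnitary_of_star_mul_self (q := symbolOp fun t => CFC.sqrt (CFC.abs (s t)))
    ?_ ?_ ?_ ?_
  · rw [star_symbolOp hv, symbolOp_mul hv.star hv, ← symbolOp_one]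
    simp only [star_polarFactor_mul_self (hu _)]
  · rw [star_symbolOp hv, symbolOp_mul hv hv.star, ← symbolOp_one]
    simp only [polarFactor_mul_star_self (hu _)]
  · rw [hqq, symbolOp_mul hp hp, star_symbolOp hs, symbolOp_mul hs.star hs]
    simp only [CFC.abs_mul_abs]
  · rw [hqq, symbolOp_mul hv hp]
    simp only [polarFactor_mul_abs (hu _)]

end Polar

/-! ### The symbol of an operator with rapidly decaying coefficients -/

theorem RapidDecay.summable_pow_mul {V : Type*} [SeminormedAddCommGroup V] {a : ℤ → V}
    (ha : RapidDecay a) (k : ℕ) : Summable fun m : ℤ => |(m : ℝ)| ^ k * ‖a m‖ := by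
  -- The two extra powers leave the summable bound `C / m ^ 2`.
  obtain ⟨C, hC⟩ := ha (k + 2)
  refine Summable.of_norm_bounded_eventually
    ((Real.summable_one_div_int_pow (p := 2)).2 one_lt_two |>.mul_left C) ?_
  filter_upwards [(Set.finite_singleton (0 : ℤ)).compl_mem_cofinite] with m (hm : m ≠ 0)
  have hm2 : 0 < (m : ℝ) ^ 2 := by positivity
  rw [Real.norm_of_nonneg (by positivity), mul_one_div, le_div_iff₀ hm2]
  calc |(m : ℝ)| ^ k * ‖a m‖ * (m : ℝ) ^ 2 = |(m : ℝ)| ^ (k + 2) * ‖a m‖ := by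
        rw [pow_add, sq_abs]; ring
    _ ≤ (1 + |(m : ℝ)|) ^ (k + 2) * ‖a m‖ := by gcongr; linarith
    _ ≤ C := hC m

theorem RapidDecay.summable_norm {V : Type*} [SeminormedAddCommGroup V] {a : ℤ → V}
    (ha : RapidDecay a) : Summable fun m : ℤ => ‖a m‖ := by
  simpa using ha.summable_pow_mul 0

theorem iteratedDeriv_character_smul {F : Type*} [NormedAddCommGroup F] [NormedSpace ℂ F]
    (m : ℤ) (x : F) (k : ℕ) :
    iteratedDeriv k (fun t => character m t • x) =
      fun t => ((m * Complex.I) ^ k * character m t) • x := by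
  induction k with
  | zero => simp
  | succ k ih =>
    rw [iteratedDeriv_succ, ih]
    funext t
    rw [(((hasDerivAt_character m t).const_mul ((m * Complex.I : ℂ) ^ k)).smul_const x).deriv]
    congr 1
    ring

/-- Each derivative multiplies the `m`-th term by a factor of modulus `|m|`, so every differentiated
series is uniformly dominated. -/
theorem RapidDecay.isSmoothLoop_tsum {F : Type*} [NormedAddCommGroup F] [NormedSpace ℂ F]
    [CompleteSpace F] {a : ℤ → F} (ha : RapidDecay a) :
    IsSmoothLoop fun t => ∑' m, character (-m) t • a m where
  contDiff := by
    refine contDiff_tsum (v := fun k (m : ℤ) => |(m : ℝ)| ^ k * ‖a m‖)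
      (fun m => (contDiff_character (-m)).smul contDiff_const)
      (fun k _ => ha.summable_pow_mul k) fun k m t _ => ?_
    rw [norm_iteratedFDeriv_eq_norm_iteratedDeriv, iteratedDeriv_character_smul, norm_smul,
      norm_mul, norm_character, norm_pow, norm_mul]
    simp
  periodic t := by simp [character_periodic _ t]

/-- The symbol as a function of the angle. -/
def symbolLoop (S : Chain N →L[ℂ] Chain N) (t : ℝ) : FiberOp N := symbol S (Circle.exp t)

theorem symbolLoop_eq (S : Chain N →L[ℂ] Chain N) :
    symbolLoop S = fun t => ∑' m, character (-m) t • coeff S m := by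
  funext t
  simp only [symbolLoop, symbol, character_eq_zpow]

theorem isSmoothLoop_symbolLoop {S : Chain N →L[ℂ] Chain N} (h : RapidDecay (coeff S)) :
    IsSmoothLoop (symbolLoop S) := by
  rw [symbolLoop_eq]; exact h.isSmoothLoop_tsum

theorem symbolOp_symbolLoop {S : Chain N →L[ℂ] Chain N} (hS : Commute S (shift N))
    (h : RapidDecay (coeff S)) : symbolOp (symbolLoop S) = S := by
  have hc : loopCoeff (symbolLoop S) = coeff S := by
    rw [symbolLoop_eq]; exact funext (loopCoeff_tsum h.summable_norm)
  rw [symbolOp, hc, laurentOp_coeff hS h.summable_norm]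

theorem isUnit_symbolLoop_iff {S : Chain N →L[ℂ] Chain N} (hS : Commute S (shift N))
    (h : RapidDecay (coeff S)) : (∀ t, IsUnit (symbolLoop S t)) ↔ IsUnit S := by
  rw [← isUnit_symbolOp_iff (isSmoothLoop_symbolLoop h), symbolOp_symbolLoop hS h]

theorem forall_det_symbol_ne_zero_iff {S : Chain N →L[ℂ] Chain N} :
    (∀ z : Circle, (symbol S z).det ≠ 0) ↔ ∀ t, IsUnit (symbolLoop S t) := by
  simp only [symbolLoop, isUnit_iff_det_ne_zero]
  exact ⟨fun h t => h _, fun h z => by simpa [Circle.exp_arg] using h (Complex.arg z)⟩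

end Gap

/-! ### The trace of the commutator with a switch function -/

section Trace

theorem isTraceClass_blockOp_and_opTrace {E : Type*} [NormedAddCommGroup E]
    [InnerProductSpace ℂ E] [CompleteSpace E] {κ : Type*} (e : HilbertBasis κ ℂ E)
    {A D : E →L[ℂ] E} (hA : IsSelfAdjoint A) (hD : IsSelfAdjoint D)
    (hsA : Summable fun j => ‖A (e j)‖) (hsD : Summable fun j => ‖D (e j)‖) :
    IsTraceClass (blockOp A 0 0 D) ∧ opTrace (blockOp A 0 0 D) = opTrace A + opTrace D := by
  obtain ⟨b, hl, hr⟩ := exists_hilbertBasis_prod e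
  have e1 (j : κ) : blockOp A 0 0 D (b (Sum.inl j)) = WithLp.toLp 2 (A (e j), 0) := by
    simp [hl, blockOp_apply]
  have e2 (j : κ) : blockOp A 0 0 D (b (Sum.inr j)) = WithLp.toLp 2 (0, D (e j)) := by
    simp [hr, blockOp_apply]
  have hs : Summable fun j => ‖blockOp A 0 0 D (b j)‖ := by
    refine (Equiv.summable_iff (Equiv.refl _)).1 (Summable.sum _ ?_ ?_)
    · simpa [Function.comp_def, e1] using hsA
    · simpa [Function.comp_def, e2] using hsD
  refine ⟨isTraceClass_of_summable_norm b ?_ hs, ?_⟩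
  · rw [IsSelfAdjoint, star_blockOp, hA.star_eq, hD.star_eq]; simp
  · have h (X : E →L[ℂ] E) (hX : Summable fun j => ‖X (e j)‖) :
        Summable fun j => inner ℂ (e j) (X (e j)) :=
      .of_norm (hX.of_nonneg_of_le (fun _ => norm_nonneg _) fun j =>
        (norm_inner_le_norm _ _).trans (by rw [e.orthonormal.1 j, one_mul]))
    have f1 (j : κ) : inner ℂ (b (Sum.inl j)) (blockOp A 0 0 D (b (Sum.inl j))) =
        inner ℂ (e j) (A (e j)) := by
      rw [e1, hl]; simp
    have f2 (j : κ) : inner ℂ (b (Sum.inr j)) (blockOp A 0 0 D (b (Sum.inr j))) =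
        inner ℂ (e j) (D (e j)) := by
      rw [e2, hr]; simp
    rw [opTrace_eq_tsum b hs, opTrace_eq_tsum e hsA, opTrace_eq_tsum e hsD, Summable.tsum_sum]
    · simp only [f1, f2]
    · simpa only [Function.comp_def, f1] using h A hsA
    · simpa only [Function.comp_def, f2] using h D hsD

/-- Moving `star U` to the other side of the inner product spares a computation of the entries of
the product. -/
theorem opTrace_star_mul {E : Type*} [NormedAddCommGroup E] [InnerProductSpace ℂ E]
    [CompleteSpace E] {κ : Type*} (e : HilbertBasis κ ℂ E) (U : E →L[ℂ] E) {Y : E →L[ℂ] E}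
    (hs : Summable fun j => ‖Y (e j)‖) :
    (Summable fun j => ‖(star U * Y) (e j)‖) ∧
      opTrace (star U * Y) = ∑' j, inner ℂ (U (e j)) (Y (e j)) := by
  have hs' : Summable fun j => ‖(star U * Y) (e j)‖ :=
    (hs.mul_left ‖star U‖).of_nonneg_of_le (fun _ => norm_nonneg _) fun p => (star U).le_opNorm (Y (e p))
  refine ⟨hs', ?_⟩
  rw [opTrace_eq_tsum e hs']
  exact tsum_congr fun p => adjoint_inner_right U _ _

theorem summable_fst_mul_const {α β : Type*} [Finite β] {G : α → ℝ} (hG : Summable G)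
    (h0 : ∀ k, 0 ≤ G k) {c : ℝ} (hc : 0 ≤ c) : Summable fun p : α × β => G p.1 * c :=
  hG.mul_of_nonneg (g := fun _ : β => c) Summable.of_finite h0 fun _ => hc

variable {Λ : ℤ → ℝ}

namespace IsSwitch

theorem exists_eq_zero_eq_one (h : IsSwitch Λ) :
    ∃ (b : ℤ) (L : ℕ), (∀ n ≤ b, Λ n = 0) ∧ ∀ n, b + L ≤ n → Λ n = 1 := by
  obtain ⟨a, ha⟩ := Filter.eventually_atTop.mp h.1
  obtain ⟨b, hb⟩ := Filter.eventually_atBot.mp h.2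
  exact ⟨b, (a - b).toNat, hb, fun n hn => ha n (by omega)⟩

theorem hasSum_sub_one (h : IsSwitch Λ) : HasSum (fun k => Λ (k + 1) - Λ k) 1 := by
  obtain ⟨b, L, h0, h1⟩ := h.exists_eq_zero_eq_one
  have hinj : Function.Injective fun i : ℕ => b + (i : ℤ) := fun i j hij => by simpa using hij
  have hsum : ∑ k ∈ (Finset.range L).image (fun i : ℕ => b + (i : ℤ)), (Λ (k + 1) - Λ k) = 1 := by
    rw [Finset.sum_image hinj.injOn]
    have := Finset.sum_range_sub (fun i : ℕ => Λ (b + i)) L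
    push_cast at this
    simp only [add_assoc]
    rw [this, add_zero, h0 b le_rfl, h1 (b + L) le_rfl, sub_zero]
  rw [← hsum]
  refine hasSum_sum_of_ne_finset_zero fun k hk => ?_
  simp only [Finset.mem_image, Finset.mem_range, not_exists, not_and] at hk
  by_cases hkb : k < b
  · rw [h0 k hkb.le, h0 (k + 1) (by omega), sub_zero]
  · have := fun hL => hk (k - b).toNat hL (by omega)
    have hk2 : b + L ≤ k := by by_contra h; exact this (by omega)
    rw [h1 k hk2, h1 (k + 1) (by omega), sub_self]

theorem summable_abs_sub_one (h : IsSwitch Λ) : Summable fun k => |Λ (k + 1) - Λ k| :=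
  h.hasSum_sub_one.summable.abs

/-- A translation by `m` is `m` unit steps, each contributing the total increment `1`. This is where
the weight `m` in the trace formula comes from. -/
theorem hasSum_sub (h : IsSwitch Λ) (m : ℤ) : HasSum (fun k => Λ (k + m) - Λ k) m := by
  induction m using Int.induction_on with
  | zero => simp
  | succ m ih =>
    have h1 := ((Equiv.addRight (m : ℤ)).hasSum_iff.2 h.hasSum_sub_one).add ih
    push_cast at h1 ⊢
    rw [add_comm (m : ℝ)]
    refine h1.congr_fun fun k => ?_
    simp [add_assoc]
  | pred m ih =>
    have h1 := ih.sub ((Equiv.addRight (-(m : ℤ) - 1)).hasSum_iff.2 h.hasSum_sub_one)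
    push_cast at h1 ⊢
    refine h1.congr_fun fun k => ?_
    simp [add_assoc]

theorem summable_abs_sub (h : IsSwitch Λ) (m : ℤ) : Summable fun k => |Λ (k + m) - Λ k| :=
  (h.hasSum_sub m).summable.abs

theorem tsum_abs_sub_nat_le (h : IsSwitch Λ) (m : ℕ) :
    ∑' k, |Λ (k + m) - Λ k| ≤ m * ∑' k, |Λ (k + 1) - Λ k| := by
  induction m with
  | zero => simp
  | succ m ih =>
    have h1 := (Equiv.addRight (m : ℤ)).summable_iff.2 h.summable_abs_sub_one
    have h2 := (Equiv.addRight (m : ℤ)).tsum_eq fun k => |Λ (k + 1) - Λ k|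
    calc ∑' k, |Λ (k + ((m + 1 : ℕ) : ℤ)) - Λ k|
        ≤ ∑' k : ℤ, (|Λ (k + m + 1) - Λ (k + m)| + |Λ (k + m) - Λ k|) := by
          refine (h.summable_abs_sub _).tsum_le_tsum (fun k => ?_)
            (h1.add (h.summable_abs_sub m))
          push_cast
          rw [← add_assoc]
          exact abs_sub_le _ _ _
      _ = ∑' k, |Λ (k + 1) - Λ k| + ∑' k : ℤ, |Λ (k + m) - Λ k| := by
          rw [← h2]
          exact h1.tsum_add (h.summable_abs_sub m)
      _ ≤ _ := by push_cast; linarith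

theorem tsum_abs_sub_le (h : IsSwitch Λ) (m : ℤ) :
    ∑' k, |Λ (k + m) - Λ k| ≤ |(m : ℝ)| * ∑' k, |Λ (k + 1) - Λ k| := by
  obtain ⟨l, rfl | rfl⟩ := m.eq_nat_or_neg
  · simpa using h.tsum_abs_sub_nat_le l
  · have e := (Equiv.addRight (l : ℤ)).tsum_eq fun k => |Λ (k + -(l : ℤ)) - Λ k|
    rw [← e]
    simp only [Equiv.coe_addRight, add_neg_cancel_right]
    simpa [abs_sub_comm] using h.tsum_abs_sub_nat_le l

/-- The sum over `k` is at most `|m|` times the total variation of `Λ`, so the first moment of `c`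
controls the double sum. -/
theorem summable_abs_sub_mul (h : IsSwitch Λ) {c : ℤ → ℝ} (hc : ∀ m, 0 ≤ c m)
    (hs : Summable fun m : ℤ => |(m : ℝ)| * c m) :
    Summable fun p : ℤ × ℤ => |Λ (p.2 + p.1) - Λ p.2| * c p.1 := by
  have hnn (p : ℤ × ℤ) : 0 ≤ |Λ (p.2 + p.1) - Λ p.2| * c p.1 := mul_nonneg (abs_nonneg _) (hc _)
  have hle (m : ℤ) : ∑' k, |Λ (k + m) - Λ k| * c m ≤
      (∑' k, |Λ (k + 1) - Λ k|) * (|(m : ℝ)| * c m) := by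
    rw [tsum_mul_right, ← mul_assoc, mul_comm _ |(m : ℝ)|]
    exact mul_le_mul_of_nonneg_right (h.tsum_abs_sub_le m) (hc m)
  refine (summable_prod_of_nonneg hnn).2 ⟨fun m => (h.summable_abs_sub m).mul_right (c m), ?_⟩
  exact (hs.mul_left _).of_nonneg_of_le (fun m => tsum_nonneg fun k => hnn (m, k)) hle

end IsSwitch

variable {N : ℕ}

theorem star_switchOp (h : IsSwitch Λ) : star (switchOp N h) = switchOp N h := by
  refine ((eq_adjoint_iff _ _).2 fun ψ φ => ?_).symm
  rw [lp.inner_eq_tsum, lp.inner_eq_tsum]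
  refine tsum_congr fun n => ?_
  rw [switchOp_apply, switchOp_apply, inner_smul_left, inner_smul_right, Complex.conj_ofReal]

theorem exists_hilbertBasis_chain (N : ℕ) : ∃ e : HilbertBasis (ℤ × Fin N) ℂ (Chain N),
    ∀ p, e p = lp.single 2 p.1 (EuclideanSpace.basisFun (Fin N) ℂ p.2) := by
  let v : ℤ × Fin N → Chain N := fun p => lp.single 2 p.1 (EuclideanSpace.basisFun (Fin N) ℂ p.2)
  have hb := orthonormal_iff_ite.1 (EuclideanSpace.basisFun (Fin N) ℂ).orthonormal
  have hv : Orthonormal ℂ v := by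
    rw [orthonormal_iff_ite]
    rintro ⟨n, i⟩ ⟨m, j⟩
    simp only [v]
    rw [lp.inner_single_left, lp.coeFn_single, Pi.single_apply]
    by_cases h : n = m
    · subst h; rw [if_pos rfl, hb]; simp
    · simp [h]
  have hspan : (Submodule.span ℂ (Set.range v))ᗮ = ⊥ := by
    rw [Submodule.eq_bot_iff]
    intro x hx
    refine lp.ext (funext fun n => ?_)
    ext i
    have h := (Submodule.mem_orthogonal _ _).1 hx _ (Submodule.subset_span ⟨(n, i), rfl⟩)
    simp only [v] at h
    rw [lp.inner_single_left] at h
    simpa [EuclideanSpace.inner_single_left] using h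
  exact ⟨HilbertBasis.mkOfOrthogonalEqBot hv hspan, fun p => by
    rw [HilbertBasis.coe_mkOfOrthogonalEqBot]⟩

/-- The trace of an operator of the fibre, as a continuous linear functional. -/
def fiberTrace (N : ℕ) : FiberOp N →L[ℂ] ℂ :=
  LinearMap.toContinuousLinearMap
    ((LinearMap.trace ℂ (EuclideanSpace ℂ (Fin N))).comp
      (ContinuousLinearMap.coeLM ℂ))

theorem fiberTrace_apply (A : FiberOp N) : fiberTrace N A = LinearMap.trace ℂ _ A.toLinearMap := rfl

theorem fiberTrace_mul_comm (A B : FiberOp N) : fiberTrace N (A * B) = fiberTrace N (B * A) :=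
  LinearMap.trace_mul_comm ℂ A.toLinearMap B.toLinearMap

theorem fiberTrace_star_mul_self (A : FiberOp N) : fiberTrace N (star A * A) =
    ∑ i, ((‖A (EuclideanSpace.basisFun (Fin N) ℂ i)‖ ^ 2 : ℝ) : ℂ) := by
  rw [fiberTrace_apply, LinearMap.trace_eq_sum_inner _ (EuclideanSpace.basisFun (Fin N) ℂ)]
  refine Finset.sum_congr rfl fun i _ => ?_
  change inner ℂ _ (star A (A _)) = _
  rw [star_eq_adjoint, adjoint_inner_right, inner_self_eq_norm_sq_to_K]
  push_cast
  rfl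

section Commutator

variable {a : ℤ → FiberOp N}

theorem hop_single (m k : ℤ) (A : FiberOp N) (v : EuclideanSpace ℂ (Fin N)) :
    hop m A (lp.single 2 k v) = lp.single 2 (k + m) (A v) := by
  refine lp.ext (funext fun n => ?_)
  rw [hop_apply]
  by_cases h : n = k + m
  · subst h; rw [add_sub_cancel_right, lp.single_apply_self, lp.single_apply_self]
  · rw [lp.single_apply_ne _ _ _ h, lp.single_apply_ne, map_zero]
    omega

theorem switchOp_single (h : IsSwitch Λ) (k : ℤ) (v : EuclideanSpace ℂ (Fin N)) :
    switchOp N h (lp.single 2 k v) = (Λ k : ℂ) • (lp.single 2 k v : Chain N) := by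
  refine lp.ext (funext fun n => ?_)
  rw [switchOp_apply]
  change _ = (Λ k : ℂ) • (lp.single 2 k v : Chain N) n
  by_cases hn : n = k
  · rw [hn]
  · rw [lp.single_apply_ne _ _ _ hn, smul_zero, smul_zero]

theorem hasSum_commutator_single (h : IsSwitch Λ) (ha : Summable fun m => ‖a m‖) (k : ℤ)
    (v : EuclideanSpace ℂ (Fin N)) :
    HasSum (fun m => ((Λ (k + m) - Λ k : ℝ) : ℂ) • (lp.single 2 (k + m) (a m v) : Chain N))
      (⁅switchOp N h, laurentOp a⁆ (lp.single 2 k v)) := by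
  have h1 := hasSum_laurentOp_apply ha (lp.single 2 k v)
  have h2 := (h1.mapL (switchOp N h)).sub (h1.const_smul (Λ k : ℂ))
  have e : ⁅switchOp N h, laurentOp a⁆ (lp.single 2 k v) =
      switchOp N h (laurentOp a (lp.single 2 k v)) -
        (Λ k : ℂ) • laurentOp a (lp.single 2 k v) := by
    rw [← map_smul, ← switchOp_single h]; rfl
  rw [e]
  refine h2.congr_fun fun m => ?_
  rw [hop_single, switchOp_single, ← sub_smul, Complex.ofReal_sub]

theorem norm_commutator_single_le (h : IsSwitch Λ) (ha : Summable fun m => ‖a m‖)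
    (ha' : Summable fun m : ℤ => |(m : ℝ)| * ‖a m‖) (k : ℤ) (v : EuclideanSpace ℂ (Fin N)) :
    ‖⁅switchOp N h, laurentOp a⁆ (lp.single 2 k v)‖ ≤
      (∑' m, |Λ (k + m) - Λ k| * ‖a m‖) * ‖v‖ := by
  have hs := (h.summable_abs_sub_mul (fun m => norm_nonneg (a m)) ha').prod_symm.prod_factor k
  have hs' := (hs.mul_right ‖v‖).hasSum
  rw [tsum_mul_right] at hs'
  refine (hasSum_commutator_single h ha k v).norm_le_of_bounded hs' fun m => ?_
  rw [norm_smul, lp.norm_single (by norm_num), Complex.norm_real, Real.norm_eq_abs, mul_assoc]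
  exact mul_le_mul_of_nonneg_left ((a m).le_opNorm v) (abs_nonneg _)

theorem summable_norm_commutator (h : IsSwitch Λ) (ha : Summable fun m => ‖a m‖)
    (ha' : Summable fun m : ℤ => |(m : ℝ)| * ‖a m‖) {e : HilbertBasis (ℤ × Fin N) ℂ (Chain N)}
    (he : ∀ p, e p = lp.single 2 p.1 (EuclideanSpace.basisFun (Fin N) ℂ p.2)) :
    Summable fun p => ‖⁅switchOp N h, laurentOp a⁆ (e p)‖ := by
  have hs := (h.summable_abs_sub_mul (fun m => norm_nonneg (a m)) ha').prod_symm.prod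
  have hs2 := summable_fst_mul_const (β := Fin N) hs
    (fun k => tsum_nonneg fun m => mul_nonneg (abs_nonneg _) (norm_nonneg _)) zero_le_one
  refine hs2.of_nonneg_of_le (fun _ => norm_nonneg _) fun p => ?_
  rw [he]
  refine (norm_commutator_single_le h ha ha' p.1 _).trans_eq ?_
  rw [(EuclideanSpace.basisFun (Fin N) ℂ).orthonormal.1]
  rfl

/-- The `m`-th term of the commutator sits at site `k + m`, where the Laurent operator has the value
`a m v`; different sites are orthogonal. -/
theorem hasSum_inner_commutator_single (h : IsSwitch Λ) (ha : Summable fun m => ‖a m‖) (k : ℤ)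
    (v : EuclideanSpace ℂ (Fin N)) :
    HasSum (fun m => ((Λ (k + m) - Λ k : ℝ) : ℂ) * ((‖a m v‖ ^ 2 : ℝ) : ℂ))
      (inner ℂ (laurentOp a (lp.single 2 k v))
        (⁅switchOp N h, laurentOp a⁆ (lp.single 2 k v))) := by
  have h1 := (hasSum_commutator_single h ha k v).mapL
    (innerSL ℂ (laurentOp a (lp.single 2 k v)))
  refine h1.congr_fun fun m => ?_
  rw [innerSL_apply_apply, inner_smul_right, lp.inner_single_right, laurentOp_single ha,
    add_sub_cancel_left, inner_self_eq_norm_sq_to_K]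
  push_cast
  rfl

/-- Fubini: for fixed `m`, the sum over sites telescopes to `m`, and the sum over the fibre basis is
the trace of `star (a m) * a m`. -/
theorem tsum_inner_commutator (h : IsSwitch Λ) (ha : Summable fun m => ‖a m‖)
    (ha' : Summable fun m : ℤ => |(m : ℝ)| * ‖a m‖) {e : HilbertBasis (ℤ × Fin N) ℂ (Chain N)}
    (he : ∀ p, e p = lp.single 2 p.1 (EuclideanSpace.basisFun (Fin N) ℂ p.2)) :
    ∑' p, inner ℂ (laurentOp a (e p)) (⁅switchOp N h, laurentOp a⁆ (e p)) =
      ∑' m : ℤ, (m : ℂ) * fiberTrace N (star (a m) * a m) := by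
  set b := EuclideanSpace.basisFun (Fin N) ℂ
  let F : ℤ → ℤ × Fin N → ℂ := fun m p =>
    ((Λ (p.1 + m) - Λ p.1 : ℝ) : ℂ) * ((‖a m (b p.2)‖ ^ 2 : ℝ) : ℂ)
  have h1 (p : ℤ × Fin N) : HasSum (fun m => F m p)
      (inner ℂ (laurentOp a (e p)) (⁅switchOp N h, laurentOp a⁆ (e p))) := by
    rw [he]; exact hasSum_inner_commutator_single h ha p.1 (b p.2)
  have hC (m : ℤ) : ‖a m‖ ≤ ∑' m, ‖a m‖ := ha.le_tsum m fun _ _ => norm_nonneg _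
  -- In `‖a m (b i)‖ ^ 2` one factor is bounded by the constant `∑ ‖a m‖`; the other keeps the decay
  -- needed for `summable_abs_sub_mul`.
  have hF : Summable (Function.uncurry F) := by
    have h2 := h.summable_abs_sub_mul (fun m => norm_nonneg (a m)) ha'
    have h3 := summable_fst_mul_const (β := Fin N) h2
      (fun p => mul_nonneg (abs_nonneg _) (norm_nonneg _))
      ((norm_nonneg (a 0)).trans (hC 0))
    refine .of_norm (((Equiv.prodAssoc ℤ ℤ (Fin N)).symm.summable_iff.2 h3).of_nonneg_of_le
      (fun _ => norm_nonneg _) ?_)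
    rintro ⟨m, k, i⟩
    simp only [Function.uncurry, F, norm_mul, Complex.norm_real, Real.norm_eq_abs, Function.comp,
      Equiv.prodAssoc_symm_apply, mul_assoc]
    refine mul_le_mul_of_nonneg_left ?_ (abs_nonneg _)
    rw [abs_of_nonneg (by positivity), sq]
    have h4 : ‖a m (b i)‖ ≤ ‖a m‖ := by
      simpa [b.orthonormal.1 i] using (a m).le_opNorm (b i)
    exact mul_le_mul h4 (h4.trans (hC m)) (norm_nonneg _) (norm_nonneg _)
  calc ∑' p, inner ℂ (laurentOp a (e p)) (⁅switchOp N h, laurentOp a⁆ (e p))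
      = ∑' p, ∑' m, F m p := tsum_congr fun p => (h1 p).tsum_eq.symm
    _ = ∑' m, ∑' p, F m p := Summable.tsum_comm (f := F) hF
    _ = _ := by
        refine tsum_congr fun m => ?_
        have h5 : HasSum (fun k => ((Λ (k + m) - Λ k : ℝ) : ℂ)) ((m : ℝ) : ℂ) :=
          Complex.hasSum_ofReal.2 (h.hasSum_sub m)
        have h6 := h5.mul (hasSum_fintype fun i => ((‖a m (b i)‖ ^ 2 : ℝ) : ℂ))
          (hF.prod_factor m)
        rw [fiberTrace_star_mul_self]
        rw [h6.tsum_eq]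
        push_cast
        rfl

end Commutator

/-- The operator equals `U† X U - X`. Self-adjointness is what `isTraceClass_of_summable_norm`
requires. -/
theorem isSelfAdjoint_star_mul_commutator {R : Type*} [Ring R] [StarRing R] {U X : R}
    (hU : star U * U = 1) (hX : star X = X) : IsSelfAdjoint (star U * ⁅X, U⁆) := by
  have e : star U * ⁅X, U⁆ = star U * X * U - X := by
    rw [Ring.lie_def, mul_sub, ← mul_assoc, ← mul_assoc, hU, one_mul]
  rw [e, IsSelfAdjoint, star_sub, star_mul, star_mul, star_star, hX, mul_assoc]

/-- For a unitary Laurent operator, `U* [Λ, U]` is trace class and its trace can be read off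
from the coefficients. -/
theorem trace_star_mul_commutator (h : IsSwitch Λ) {a : ℤ → FiberOp N}
    (ha : Summable fun m => ‖a m‖) (ha' : Summable fun m : ℤ => |(m : ℝ)| * ‖a m‖)
    (hU : star (laurentOp a) * laurentOp a = 1) {e : HilbertBasis (ℤ × Fin N) ℂ (Chain N)}
    (he : ∀ p, e p = lp.single 2 p.1 (EuclideanSpace.basisFun (Fin N) ℂ p.2)) :
    IsSelfAdjoint (star (laurentOp a) * ⁅switchOp N h, laurentOp a⁆) ∧
      (Summable fun p => ‖(star (laurentOp a) * ⁅switchOp N h, laurentOp a⁆) (e p)‖) ∧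
      opTrace (star (laurentOp a) * ⁅switchOp N h, laurentOp a⁆) =
        ∑' m : ℤ, (m : ℂ) * fiberTrace N (star (a m) * a m) := by
  obtain ⟨hs, ht⟩ := opTrace_star_mul e (laurentOp a) (summable_norm_commutator h ha ha' he)
  exact ⟨isSelfAdjoint_star_mul_commutator hU (star_switchOp h), hs,
    ht.trans (tsum_inner_commutator h ha ha' he)⟩

end Trace

/-! ### The winding number -/

section Winding

variable {N : ℕ}

/-- The matrix of an operator of the fibre in the standard basis. -/
def fiberMatrix (A : FiberOp N) : Matrix (Fin N) (Fin N) ℂ :=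
  LinearMap.toMatrix (EuclideanSpace.basisFun (Fin N) ℂ).toBasis
    (EuclideanSpace.basisFun (Fin N) ℂ).toBasis A.toLinearMap

theorem det_fiberMatrix (A : FiberOp N) : (fiberMatrix A).det = A.det :=
  LinearMap.det_toMatrix _ _

theorem fiberMatrix_apply (A : FiberOp N) (i j : Fin N) :
    fiberMatrix A i j = A (EuclideanSpace.basisFun (Fin N) ℂ j) i := by
  rw [fiberMatrix, LinearMap.toMatrix_apply]
  simp

theorem trace_fiberMatrix (A : FiberOp N) : (fiberMatrix A).trace = fiberTrace N A :=
  (LinearMap.trace_eq_matrix_trace ℂ (EuclideanSpace.basisFun (Fin N) ℂ).toBasis _).symm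

theorem fiberMatrix_star (A : FiberOp N) : fiberMatrix (star A) = (fiberMatrix A).conjTranspose := by
  ext i j
  rw [Matrix.conjTranspose_apply, fiberMatrix_apply, fiberMatrix_apply]
  have h := adjoint_inner_right A (EuclideanSpace.basisFun (Fin N) ℂ i)
    (EuclideanSpace.basisFun (Fin N) ℂ j)
  simpa [EuclideanSpace.inner_single_left, EuclideanSpace.inner_single_right,
    EuclideanSpace.basisFun_apply, ← star_eq_adjoint] using h

theorem det_star (A : FiberOp N) : (star A).det = star A.det := by
  rw [← det_fiberMatrix, fiberMatrix_star, Matrix.det_conjTranspose, det_fiberMatrix]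

theorem det_mul (A B : FiberOp N) : (A * B).det = A.det * B.det :=
  LinearMap.det_comp A.toLinearMap B.toLinearMap

theorem differentiable_det : Differentiable ℂ fun A : FiberOp N => A.det := by
  simp only [← det_fiberMatrix, Matrix.det_apply', fiberMatrix_apply]
  have h (i j : Fin N) : ContDiff ℂ 1 fun A : FiberOp N =>
      A (EuclideanSpace.basisFun (Fin N) ℂ j) i :=
    ((EuclideanSpace.proj i).comp
      (ContinuousLinearMap.apply ℂ _ (EuclideanSpace.basisFun (Fin N) ℂ j))).contDiff
  refine Differentiable.fun_sum fun σ _ => (Differentiable.const_mul ?_ _)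
  exact (contDiff_prod fun i _ => h (σ i) i).differentiable one_ne_zero

theorem continuous_det : Continuous fun A : FiberOp N => A.det := differentiable_det.continuous

theorem fiberMatrix_one_add_smul (c : ℂ) (X : FiberOp N) :
    fiberMatrix (1 + c • X) = 1 + c • fiberMatrix X := by
  change LinearMap.toMatrix _ _ (LinearMap.id + c • X.toLinearMap) = _
  rw [map_add, map_smul, LinearMap.toMatrix_id]
  rfl

theorem hasDerivAt_det_one_add_smul (X : FiberOp N) :
    HasDerivAt (fun c : ℂ => (1 + c • X).det) (fiberTrace N X) 0 := by
  have h := (Matrix.det (1 + (Polynomial.X : Polynomial ℂ) •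
    (fiberMatrix X).map Polynomial.C)).hasDerivAt 0
  rw [Matrix.derivative_det_one_add_X_smul, trace_fiberMatrix] at h
  refine h.congr_of_eventuallyEq (.of_forall fun c => ?_)
  simp only
  rw [← det_fiberMatrix, ← Polynomial.coe_evalRingHom, RingHom.map_det]
  congr 1
  ext i j
  rw [fiberMatrix_one_add_smul]
  by_cases hij : i = j
  · simp [hij, mul_comm c]
  · simp [hij, mul_comm c]

theorem fderiv_det_one (X : FiberOp N) :
    fderiv ℂ (fun A : FiberOp N => A.det) 1 X = fiberTrace N X := by
  have h1 : HasDerivAt (fun c : ℂ => 1 + c • X) X 0 := by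
    simpa using ((hasDerivAt_id (0 : ℂ)).smul_const X).const_add 1
  have h2 := (differentiable_det (1 : FiberOp N)).hasFDerivAt.comp_hasDerivAt_of_eq 0 h1
    (by rw [zero_smul ℂ X, add_zero])
  exact h2.unique (hasDerivAt_det_one_add_smul X)

/-- Jacobi's formula. -/
theorem hasDerivAt_det {u : ℝ → FiberOp N} {u' v : FiberOp N} {t : ℝ} (hu : HasDerivAt u u' t)
    (h1 : v * u t = 1) (h2 : u t * v = 1) :
    HasDerivAt (fun t => (u t).det) ((u t).det * fiberTrace N (v * u')) t := by
  -- The path `v * u r` passes through `1` at `r = t`, so only the derivative of the determinant at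
  -- the identity, the trace, is needed.
  have hd : HasDerivAt (fun r => v * u r) (v * u') t := hu.const_mul v
  have h3 : HasFDerivAt (fun A : FiberOp N => A.det) (fderiv ℂ (fun A : FiberOp N => A.det) 1)
      (v * u t) := by
    rw [h1]; exact (differentiable_det 1).hasFDerivAt
  have h4 := (h3.restrictScalars ℝ).comp_hasDerivAt t hd
  have h5 := h4.const_mul (u t).det
  refine (h5.congr_deriv ?_).congr_of_eventuallyEq (.of_forall fun r => ?_)
  · exact congrArg _ (fderiv_det_one _)
  · simp only [Function.comp_apply]
    rw [← det_mul, ← mul_assoc, h2, one_mul]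

/-- Continuous logarithm of the determinant of a loop of unitaries; its increment over a period
is a multiple of `2 π i`. -/
theorem exists_log_det {u : ℝ → FiberOp N} (hu : IsSmoothLoop u) (h1 : ∀ t, star (u t) * u t = 1)
    (h2 : ∀ t, u t * star (u t) = 1) : ∃ (G : ℝ → ℂ) (w : ℤ), Continuous G ∧
      (∀ t, Complex.exp (G t) = (u t).det) ∧
      G (2 * Real.pi) - G 0 = 2 * Real.pi * Complex.I * w ∧
      ∫ t in (0 : ℝ)..2 * Real.pi, fiberTrace N (star (u t) * deriv u t) =
        2 * Real.pi * Complex.I * w := by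
  set F : ℝ → ℂ := fun t => fiberTrace N (star (u t) * deriv u t)
  have hF : Continuous F := ((hu.star.mul hu.deriv).clm_apply (fiberTrace N)).continuous
  have hdet0 : (u 0).det ≠ 0 := isUnit_iff_det_ne_zero.1 (isUnit_iff_exists.2 ⟨_, h2 0, h1 0⟩)
  set G : ℝ → ℂ := fun t => Complex.log (u 0).det + ∫ r in (0 : ℝ)..t, F r
  have hG (t : ℝ) : HasDerivAt G (F t) t :=
    (intervalIntegral.integral_hasDerivAt_right (hF.intervalIntegrable _ _)
      (hF.stronglyMeasurableAtFilter _ _) hF.continuousAt).const_add _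
  have hG0 : G 0 = Complex.log (u 0).det := by simp [G]
  have hexp (t : ℝ) : Complex.exp (G t) = (u t).det := by
    -- By Jacobi's formula `det u` and `exp G` solve the same linear differential equation, so their
    -- quotient is constant.
    have hd (t : ℝ) : HasDerivAt (fun t => (u t).det * Complex.exp (-G t)) 0 t := by
      have h3 := (hasDerivAt_det (hu.hasDerivAt t) (h1 t) (h2 t)).mul (hG t).neg.cexp
      refine h3.congr_deriv ?_
      simp only [F]
      ring
    have hc := is_const_of_deriv_eq_zero (fun t => (hd t).differentiableAt)
      (fun t => (hd t).deriv) t 0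
    rw [hG0, Complex.exp_neg, Complex.exp_neg, Complex.exp_log hdet0, mul_inv_cancel₀ hdet0,
      mul_inv_eq_one₀ (Complex.exp_ne_zero _)] at hc
    exact hc.symm
  have hper : u (2 * Real.pi) = u 0 := by simpa using hu.periodic 0
  have hdiff : G (2 * Real.pi) - G 0 = ∫ t in (0 : ℝ)..2 * Real.pi, F t := by simp [G]
  have hone : Complex.exp (G (2 * Real.pi) - G 0) = 1 := by
    rw [Complex.exp_sub, hexp, hexp, hper, div_self hdet0]
  obtain ⟨w, hw⟩ := Complex.exp_eq_one_iff.1 hone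
  have hw' : G (2 * Real.pi) - G 0 = 2 * Real.pi * Complex.I * w := by rw [hw]; ring
  exact ⟨G, w, continuous_iff_continuousAt.2 fun t => (hG t).continuousAt, hexp, hw',
    hdiff ▸ hw'⟩

/-- Parseval: the integral is `2 π` times the zeroth coefficient of the trace of `u† u'`, computed
by convolution. The derivative supplies the factor `-i m`. -/
theorem integral_fiberTrace_star_mul_deriv {u : ℝ → FiberOp N} (hu : IsSmoothLoop u) :
    ∫ t in (0 : ℝ)..2 * Real.pi, fiberTrace N (star (u t) * deriv u t) =
      -(2 * Real.pi * Complex.I) *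
        ∑' m : ℤ, (m : ℂ) * fiberTrace N (star (loopCoeff u m) * loopCoeff u m) := by
  have hpi : (2 * Real.pi : ℂ) ≠ 0 := by exact_mod_cast Real.two_pi_pos.ne'
  have hm := hu.star.mul hu.deriv
  have h1 := clm_loopCoeff (fiberTrace N) hm.continuous 0
  rw [hu.star.loopCoeff_mul hu.deriv] at h1
  have h2 : loopCoeff (fun t => fiberTrace N (star (u t) * deriv u t)) 0 =
      (2 * Real.pi : ℂ)⁻¹ *
        ∫ t in (0 : ℝ)..2 * Real.pi, fiberTrace N (star (u t) * deriv u t) := by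
    simp [loopCoeff, character_zero]
  have hs : Summable fun k => loopCoeff (fun t => star (u t)) k * loopCoeff (deriv u) (0 - k) :=
    ((summable_norm_convEquiv hu.star.summable_norm_loopCoeff
      hu.deriv.summable_norm_loopCoeff).prod_factor 0).of_norm
  rw [h2, conv, (fiberTrace N).map_tsum hs, ← (Equiv.neg ℤ).tsum_eq] at h1
  have h3 (k : ℤ) : fiberTrace N (loopCoeff (fun t => star (u t)) (Equiv.neg ℤ k) *
      loopCoeff (deriv u) (0 - Equiv.neg ℤ k)) =
      -Complex.I * (k * fiberTrace N (star (loopCoeff u k) * loopCoeff u k)) := by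
    rw [Equiv.neg_apply, hu.loopCoeff_star, zero_sub, neg_neg, hu.loopCoeff_deriv, mul_smul_comm,
      map_smul, smul_eq_mul]
    ring
  simp only [h3] at h1
  rw [tsum_mul_left] at h1
  rw [← mul_right_inj' (inv_ne_zero hpi), ← h1]
  field_simp

/-- The determinant of `A` is a positive multiple of that of its polar factor. -/
theorem det_eq_polarFactor_mul {A : FiberOp N} (hA : IsUnit A) :
    A.det = (polarFactor A).det * ((‖(CFC.sqrt (CFC.abs A)).det‖ ^ 2 : ℝ) : ℂ) := by
  conv_lhs => rw [← polarFactor_mul_abs hA, det_mul]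
  congr 1
  conv_lhs => rw [← CFC.sqrt_mul_sqrt_self (CFC.abs A) (CFC.abs_nonneg A), det_mul]
  -- The root is self-adjoint, so its determinant equals its own conjugate and the square is a
  -- squared modulus.
  have h := det_star (CFC.sqrt (CFC.abs A))
  rw [(IsSelfAdjoint.of_nonneg (CFC.sqrt_nonneg (CFC.abs A))).star_eq] at h
  nth_rewrite 1 [h]
  rw [Complex.star_def, ← Complex.normSq_eq_conj_mul_self, Complex.normSq_eq_norm_sq]

/-- The positive periodic factor between `det S` and the determinant of the polar factor has a real
periodic logarithm, which adds nothing to the increment over a period. -/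
theorem hasWindingNumber_det_symbol {S : Chain N →L[ℂ] Chain N} (h : RapidDecay (coeff S))
    (hu : ∀ t, IsUnit (symbolLoop S t)) : ∃ w : ℤ,
      HasWindingNumber (fun z => (symbol S z).det) w ∧
      ∑' m : ℤ, (m : ℂ) * fiberTrace N
        (star (loopCoeff (fun t => polarFactor (symbolLoop S t)) m) *
          loopCoeff (fun t => polarFactor (symbolLoop S t)) m) = -w := by
  have hs := isSmoothLoop_symbolLoop h
  have hv := hs.polarFactor hu
  obtain ⟨G, w, hGc, hGexp, hGw, hint⟩ := exists_log_det hv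
    (fun t => star_polarFactor_mul_self (hu t)) fun t => polarFactor_mul_star_self (hu t)
  have h2pi : (2 * Real.pi * Complex.I : ℂ) ≠ 0 := Complex.two_pi_I_ne_zero
  refine ⟨w, ?_, ?_⟩
  · have hq := (hs.abs hu).sqrt (fun t => CFC.abs_nonneg _) fun t => isUnit_abs_of_isUnit (hu t)
    set r : ℝ → ℝ := fun t => ‖(CFC.sqrt (CFC.abs (symbolLoop S t))).det‖ ^ 2
    have hr (t : ℝ) : 0 < r t := by
      have hunit := isUnit_abs_of_isUnit (hu t)
      rw [← CFC.sqrt_mul_sqrt_self _ (CFC.abs_nonneg (symbolLoop S t))] at hunit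
      have := isUnit_iff_det_ne_zero.1 ((Commute.refl _).isUnit_mul_iff.1 hunit).1
      positivity
    have hrc : Continuous r := (continuous_det.comp hq.continuous).norm.pow 2
    have hrp : r (2 * Real.pi) = r 0 := by
      have := hs.periodic 0
      rw [zero_add] at this
      simp only [r, this]
    refine ⟨fun t => G t + (Real.log (r t) : ℂ),
      hGc.add (Complex.continuous_ofReal.comp (hrc.log fun t => (hr t).ne')), fun t => ?_, ?_⟩
    · rw [Complex.exp_add, hGexp, ← Complex.ofReal_exp, Real.exp_log (hr t)]
      exact (det_eq_polarFactor_mul (hu t)).symm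
    · simp only [hrp]
      rw [← hGw]
      ring
  · rw [integral_fiberTrace_star_mul_deriv hv] at hint
    rw [neg_mul, neg_eq_iff_eq_neg, ← mul_neg] at hint
    exact mul_left_cancel₀ h2pi hint

end Winding

section Main

variable {N : ℕ}

theorem opTrace_neg {E : Type*} [NormedAddCommGroup E] [InnerProductSpace ℂ E] [CompleteSpace E]
    (X : E →L[ℂ] E) : opTrace (-X) = -opTrace X := by
  simp [opTrace, tsum_neg]

theorem switchOp₂_eq {Λ : ℤ → ℝ} (h : IsSwitch Λ) :
    switchOp₂ N h = blockOp (switchOp N h) 0 0 (switchOp N h) := rfl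

/-- Both traces for a unitary operator with smooth symbol. -/
theorem traces_of_isPolarUnitary {S : Chain N →L[ℂ] Chain N} (hS : IsUnit S)
    {u : ℝ → FiberOp N} (hu : IsSmoothLoop u) (hU : IsPolarUnitary S (symbolOp u))
    {Λ : ℤ → ℝ} (h : IsSwitch Λ) {w : ℤ}
    (hw : ∑' m : ℤ, (m : ℂ) * fiberTrace N (star (loopCoeff u m) * loopCoeff u m) = -w) :
    (IsTraceClass (star (symbolOp u) * ⁅switchOp N h, symbolOp u⁆) ∧
      opTrace (star (symbolOp u) * ⁅switchOp N h, symbolOp u⁆) = -(w : ℂ)) ∧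
    IsTraceClass (chirality * signHamiltonian S * ⁅switchOp₂ N h, signHamiltonian S⁆) ∧
    bulkIndex S h = -(w : ℂ) := by
  have hU1 : star (symbolOp u) * symbolOp u = 1 := (Unitary.mem_iff.1 hU.1).1
  have hU2 : symbolOp u * star (symbolOp u) = 1 := (Unitary.mem_iff.1 hU.1).2
  obtain ⟨e, he⟩ := exists_hilbertBasis_chain N
  obtain ⟨sa, sums, tr⟩ := trace_star_mul_commutator h hu.summable_norm_loopCoeff
    hu.summable_abs_mul_norm_loopCoeff hU1 he
  have hU2' : star (symbolOp fun t => star (u t)) * symbolOp (fun t => star (u t)) = 1 := by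
    rw [← star_symbolOp hu, star_star, hU2]
  obtain ⟨sa', sums', tr'⟩ := trace_star_mul_commutator h hu.star.summable_norm_loopCoeff
    hu.star.summable_abs_mul_norm_loopCoeff hU2' he
  have hw' : ∑' m : ℤ, (m : ℂ) * fiberTrace N (star (loopCoeff (fun t => star (u t)) m) *
      loopCoeff (fun t => star (u t)) m) = w := by
    rw [← neg_eq_iff_eq_neg] at hw
    rw [← hw, ← (Equiv.neg ℤ).tsum_eq, ← tsum_neg]
    refine tsum_congr fun m => ?_
    rw [Equiv.neg_apply, hu.loopCoeff_star, neg_neg, star_star, fiberTrace_mul_comm]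
    push_cast
    ring
  change IsSelfAdjoint (star (symbolOp u) * ⁅switchOp N h, symbolOp u⁆) at sa
  change Summable fun p => ‖(star (symbolOp u) * ⁅switchOp N h, symbolOp u⁆) (e p)‖ at sums
  change IsSelfAdjoint (star (symbolOp fun t => star (u t)) *
    ⁅switchOp N h, symbolOp fun t => star (u t)⁆) at sa'
  change Summable fun p => ‖(star (symbolOp fun t => star (u t)) *
    ⁅switchOp N h, symbolOp fun t => star (u t)⁆) (e p)‖ at sums'
  change opTrace (star (symbolOp fun t => star (u t)) *
    ⁅switchOp N h, symbolOp fun t => star (u t)⁆) = _ at tr'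
  rw [← star_symbolOp hu, star_star] at sa' sums' tr'
  rw [hw'] at tr'
  change opTrace (star (symbolOp u) * ⁅switchOp N h, symbolOp u⁆) = _ at tr
  rw [hw] at tr
  refine ⟨⟨isTraceClass_of_summable_norm e sa sums, tr⟩, ?_⟩
  rw [bulkIndex, switchOp₂_eq, chirality_mul_signHamiltonian_mul_commutator hS hU]
  have sums'' : Summable fun p => ‖(-(symbolOp u * ⁅switchOp N h, star (symbolOp u)⁆)) (e p)‖ := by
    simpa only [neg_apply, norm_neg] using sums'
  obtain ⟨h1, h2⟩ := isTraceClass_blockOp_and_opTrace e sa sa'.neg sums sums''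
  refine ⟨h1, ?_⟩
  have h3 := congrArg (fun c : ℂ => 1 / 2 * c) h2
  rw [opTrace_neg, tr', tr] at h3
  refine h3.trans ?_
  ring

end Main

end ChiralChain

end

theorem proposition3p5 (N : ℕ) (S : ChiralChain.Chain N →L[ℂ] ChiralChain.Chain N)
    (hS : Commute S (ChiralChain.shift N))
    (hdecay : ChiralChain.RapidDecay (ChiralChain.coeff S)) :
    -- the symbol converges absolutely on the unit circle
    (∀ z : Circle, Summable fun m : ℤ => ‖(z : ℂ) ^ (-m) • ChiralChain.coeff S m‖) ∧
    -- the spectral gap condition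
    (0 ∉ spectrum ℂ (ChiralChain.hamiltonian S) ↔
      ∀ z : Circle, (ChiralChain.symbol S z).det ≠ 0) ∧
    -- in the gapped case both expressions of the index are well defined and equal to minus
    -- the winding number of the determinant of the symbol
    (0 ∉ spectrum ℂ (ChiralChain.hamiltonian S) →
      ∃ w : ℤ, ChiralChain.HasWindingNumber (fun z => (ChiralChain.symbol S z).det) w ∧
        (∃! U, ChiralChain.IsPolarUnitary S U) ∧
        ∀ (Λ : ℤ → ℝ) (hΛ : ChiralChain.IsSwitch Λ),
          (∀ U, ChiralChain.IsPolarUnitary S U →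
            ChiralChain.IsTraceClass (star U * ⁅ChiralChain.switchOp N hΛ, U⁆) ∧
            ChiralChain.opTrace (star U * ⁅ChiralChain.switchOp N hΛ, U⁆) = -(w : ℂ)) ∧
          ChiralChain.IsTraceClass (ChiralChain.chirality * ChiralChain.signHamiltonian S *
            ⁅ChiralChain.switchOp₂ N hΛ, ChiralChain.signHamiltonian S⁆) ∧
          ChiralChain.bulkIndex S hΛ = -(w : ℂ)) := by
  refine ⟨fun z => ?_, ?_, fun h0 => ?_⟩
  · simpa only [norm_smul, norm_zpow, Circle.norm_coe, one_zpow, one_mul] using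
      hdecay.summable_norm
  · rw [ChiralChain.zero_notMem_spectrum_hamiltonian_iff,
      ChiralChain.forall_det_symbol_ne_zero_iff, ChiralChain.isUnit_symbolLoop_iff hS hdecay]
  · have hSu : IsUnit S := ChiralChain.zero_notMem_spectrum_hamiltonian_iff.1 h0
    have hu := (ChiralChain.isUnit_symbolLoop_iff hS hdecay).2 hSu
    have hs := ChiralChain.isSmoothLoop_symbolLoop hdecay
    obtain ⟨w, hw, hsum⟩ := ChiralChain.hasWindingNumber_det_symbol hdecay hu
    have hpol := ChiralChain.isPolarUnitary_symbolOp hs hu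
    rw [ChiralChain.symbolOp_symbolLoop hS hdecay] at hpol
    refine ⟨w, hw, ⟨_, hpol, fun U hU => hU.unique hSu hpol⟩, fun Λ hΛ => ?_⟩
    obtain ⟨h1, h2⟩ := ChiralChain.traces_of_isPolarUnitary hSu (hs.polarFactor hu) hpol hΛ hsum
    refine ⟨fun U hU => ?_, h2⟩
    rw [hU.unique hSu hpol]
    exact h1
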